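/- Let $\mathbb D=\{z\in\mathbb C:|z|<1\}$ and let $\mathcal A$ be the class of analytic functions $f$ on $\mathbb D$ with $f(0)=0$, $f'(0)=1$. For $\alpha\ge 0$, $\gamma>0$ and $\beta<1$ let $W_\beta(\alpha,\gamma)$ be the class of all $f\in\mathcal A$ for which there is $\phi\in\mathbb R$ with $$\operatorname{Re}\Big(e^{i\phi}\Big((1-\alpha+2\gamma)\tfrac{f(z)}{z}+(\alpha-2\gamma)f'(z)+\gamma z f''(z)-\beta\Big)\Big)>0\qquad(z\in\mathbb D),$$ and for $0\le\xi\le1$ let $M(\xi)$ be the class of all $F\in\mathcal A$ with $$\operatorname{Re}\,\frac{\xi z(zF'(z))'+(1-\xi)zF'(z)}{\xi zF'(z)+(1-\xi)F(z)}>0\qquad(z\in\mathbb D)$$ (quotients are continued analytically to $z=0$). Theorem. Let $0\le\xi\le1$, $a>-1$, $b>-1$, $\alpha\ge 0$, $\gamma>0$, and let $\mu\ge1$, $\nu>0$ satisfy $\mu+\nu=\alpha-\gamma$ and $\mu\nu=\gamma$. Put $$\lambda(t)=\begin{cases}(a+1)(b+1)\,\dfrac{t^a(1-t^{b-a})}{b-a},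 & b\ne a,\\[2mm](a+1)^2\,t^a\log(1/t), & b=a,\end{cases}\qquad 0<t<1,$$ and $q(t)=\sum_{n=0}^\infty\dfrac{(n+1)^2(-1)^nt^n}{(1+\mu n)(1+\nu n)}$ for $0\le t<1$. Let $\beta<1$ satisfy $$\frac{\beta-\frac12}{1-\beta}=-\int_0^1\lambda(t)q(t)\,dt .$$ If one of the conditions (i) $b>a$, $-1<a<0$ and $b+a-1<\frac1\mu<b-1$; (ii) $b<a$, $-1<b<0$ and $b+a-1<\frac1\mu<a-1$; (iii) $b=a<0$ and $\frac1\mu>b-1$ holds, then for every $f\in W_\beta(\alpha,\gamma)$ the function $V_\lambda(f)(z)=\int_0^1\lambda(t)\dfrac{f(tz)}{t}\,dt$ belongs to $M(\xi)$. -/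

import Mathlib

open MeasureTheory Metric

noncomputable section

namespace Pascu

/-- The class `𝒜`: analytic functions in the open unit disc with `f 0 = 0`, `f' 0 = 1`. -/
def classA : Set (ℂ → ℂ) :=
  {f | DifferentiableOn ℂ f (ball 0 1) ∧ f 0 = 0 ∧ deriv f 0 = 1}

/-- The class `W_β(α, γ)`. For `f 0 = 0` the function `dslope f 0` is `f z / z`, with the
removable singularity at `0` filled in by `f' 0`. -/
def classW (β α γ : ℝ) : Set (ℂ → ℂ) :=
  {f | f ∈ classA ∧ ∃ φ : ℝ, ∀ z ∈ ball (0 : ℂ) 1,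
    0 < (Complex.exp (Complex.I * (φ : ℂ)) *
      ((1 - (α : ℂ) + 2 * (γ : ℂ)) * dslope f 0 z + ((α : ℂ) - 2 * (γ : ℂ)) * deriv f z
        + (γ : ℂ) * z * deriv (deriv f) z - (β : ℂ))).re}

/-- The Pascu class `M(ξ)`. The quotient has a removable singularity at `z = 0`, with value `1`,
so the condition is imposed for `z ≠ 0`. Since `w / 0 = 0` in Lean, positivity of the real part
forces the denominator to be nonzero. -/
def classM (ξ : ℝ) : Set (ℂ → ℂ) :=
  {F | F ∈ classA ∧ ∀ z ∈ ball (0 : ℂ) 1, z ≠ 0 →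
    0 < (((ξ : ℂ) * z * deriv (fun w => w * deriv F w) z + (1 - (ξ : ℂ)) * (z * deriv F z)) /
      ((ξ : ℂ) * (z * deriv F z) + (1 - (ξ : ℂ)) * F z)).re}

/-- The integral transform `V_λ(f)(z) = ∫₀¹ λ(t) f(tz) / t dt`. -/
def V (lam : ℝ → ℝ) (f : ℂ → ℂ) (z : ℂ) : ℂ :=
  ∫ t in (0 : ℝ)..1, (lam t : ℂ) * (f ((t : ℂ) * z) / (t : ℂ))

/-- The function `q(t) = ∑ (n+1)² (-1)ⁿ tⁿ / ((1+μn)(1+νn))`, `0 ≤ t < 1`. -/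
def q (μ ν t : ℝ) : ℝ :=
  ∑' n : ℕ, ((n : ℝ) + 1) ^ 2 * (-1) ^ n * t ^ n / ((1 + μ * n) * (1 + ν * n))

/-- The weight `λ`, on `0 < t < 1`. -/
def weight (a b t : ℝ) : ℝ :=
  if b = a then (a + 1) ^ 2 * t ^ a * Real.log (1 / t)
  else (a + 1) * (b + 1) * (t ^ a * (1 - t ^ (b - a)) / (b - a))

end Pascu

end

namespace Pascu

/-! The proof is a duality argument carried out on coefficients. Write `f z = z * ∑ cₙ zⁿ` and let
`mₙ` be the moments of the weight. The expression defining `classW` has coefficients `(1 + μ n)(1 +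
ν n) cₙ`, and the transform of `f` is `z * ∑ mₙ cₙ zⁿ`. Membership in `classM ξ` says that the
function with coefficients `Eₙ = (1 + ξ n) mₙ cₙ` (times `z`) is starlike. By
`re_div_pos_of_forall_unit` this follows if, for each `z`, some fixed rotation of `∑ starCoeff x n *
Eₙ zⁿ` has positive real part for all unimodular `x`.

That sum is, up to the factor `1 - β`, the Hadamard product of a series `P` with positive real part
(the hypothesis on `f`) and a series `s` that depends only on the weight, `ξ`, `β`, `μ`, `ν` and
`x`. By `re_pSum_mul_pos` it is enough that `Re s ≥ 1/2`. The equation for `β` turns this into the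
bound `Re κ ≥ ∫ lam q`, where `κ` collects the multipliers.

For the bound, decrease of `lam t / (1 - t ^ 2)` shows that the weighted starlikeness kernel at `w`
is minorized by the case `x = 1` at `-|w|` (`integral_weight_kernel_nonneg`). The remaining
multipliers are positive combinations of averages over `t ^ ν` and `t ^ μ`, so they preserve both
this minorization and the monotonicity of the minorant; letting `|w|` grow to `1` in the minorant
leaves `∫ lam q`. The conditions on `a`, `b` are used only to prove the weight `Admissible`. -/

/-- The power series with coefficients `c` converges absolutely on the open unit disc. -/
def ConvOnDisc (c : ℕ → ℂ) : Prop :=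
  ∀ r : ℝ, 0 ≤ r → r < 1 → Summable fun n => ‖c n‖ * r ^ n

/-- The sum of the power series with coefficients `c`. -/
noncomputable def pSum (c : ℕ → ℂ) (z : ℂ) : ℂ := ∑' n, c n * z ^ n

/-! ### Calculus of power series on the unit disc. -/

namespace ConvOnDisc

variable {c d : ℕ → ℂ}

lemma hasSum (hc : ConvOnDisc c) {z : ℂ} (hz : ‖z‖ < 1) :
    HasSum (fun n => c n * z ^ n) (pSum c z) := by
  refine Summable.hasSum (Summable.of_norm ?_)
  simpa using hc ‖z‖ (norm_nonneg z) hz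

lemma of_summable (h : ∀ z : ℂ, ‖z‖ < 1 → Summable fun n => c n * z ^ n) : ConvOnDisc c := by
  intro r hr0 hr1
  have hr : ‖(r : ℂ)‖ = r := by simp [abs_of_nonneg hr0]
  simpa [abs_of_nonneg hr0] using (h (r : ℂ) (by rwa [hr])).norm

lemma of_le (hc : ConvOnDisc c) (C : ℝ) (h : ∀ n, ‖d n‖ ≤ C * ‖c n‖) : ConvOnDisc d := by
  intro r hr0 hr1
  refine Summable.of_nonneg_of_le (fun n => by positivity) (fun n => ?_) ((hc r hr0 hr1).mul_left C)
  calc ‖d n‖ * r ^ n ≤ C * ‖c n‖ * r ^ n := by gcongr; exact h n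
    _ = C * (‖c n‖ * r ^ n) := by ring

lemma mul_of_bounded (hc : ConvOnDisc c) {m : ℕ → ℂ} (C : ℝ) (h : ∀ n, ‖m n‖ ≤ C) :
    ConvOnDisc fun n => m n * c n :=
  hc.of_le C fun n => by rw [norm_mul]; gcongr; exact h n

lemma const_mul (hc : ConvOnDisc c) (k : ℂ) : ConvOnDisc fun n => k * c n :=
  hc.mul_of_bounded ‖k‖ fun _ => le_rfl

lemma add (hc : ConvOnDisc c) (hd : ConvOnDisc d) : ConvOnDisc fun n => c n + d n := by
  intro r hr0 hr1
  refine Summable.of_nonneg_of_le (fun n => by positivity) (fun n => ?_)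
    ((hc r hr0 hr1).add (hd r hr0 hr1))
  rw [← add_mul]
  gcongr
  exact norm_add_le _ _

lemma natCast_mul (hc : ConvOnDisc c) : ConvOnDisc fun n => (n : ℂ) * c n := by
  intro r hr0 hr1
  obtain ⟨s, hrs, hs1⟩ := exists_between hr1
  have hs0 : 0 < s := hr0.trans_lt hrs
  have hq : ‖r / s‖ < 1 := by
    rw [Real.norm_of_nonneg (by positivity)]
    exact (div_lt_one hs0).2 hrs
  have h1 := summable_pow_mul_geometric_of_norm_lt_one 1 hq
  -- The factor `n` is absorbed by passing to the larger radius `s`: `n (r / s) ^ n` is bounded.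
  obtain ⟨C, hC⟩ := h1.tendsto_atTop_zero.bddAbove_range
  refine Summable.of_nonneg_of_le (fun n => by positivity) (fun n => ?_)
    ((hc s hs0.le hs1).mul_left C)
  have h2 : (n : ℝ) ^ 1 * (r / s) ^ n ≤ C := hC ⟨n, rfl⟩
  calc ‖(n : ℂ) * c n‖ * r ^ n = ((n : ℝ) ^ 1 * (r / s) ^ n) * (‖c n‖ * s ^ n) := by
        rw [norm_mul, Complex.norm_natCast, div_pow]; field_simp
    _ ≤ C * (‖c n‖ * s ^ n) := by gcongr

lemma linear_mul (hc : ConvOnDisc c) (p q : ℂ) : ConvOnDisc fun n => (p + q * n) * c n := by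
  convert (hc.const_mul p).add (hc.natCast_mul.const_mul q) using 2
  ring

lemma pSum_add (hc : ConvOnDisc c) (hd : ConvOnDisc d) {z : ℂ} (hz : ‖z‖ < 1) :
    pSum (fun n => c n + d n) z = pSum c z + pSum d z := by
  refine ((hc.add hd).hasSum hz).unique ?_
  convert (hc.hasSum hz).add (hd.hasSum hz) using 2
  ring

lemma pSum_const_mul (k : ℂ) (z : ℂ) : pSum (fun n => k * c n) z = k * pSum c z := by
  simp only [pSum, mul_assoc, tsum_mul_left]

lemma hasDerivAt (hc : ConvOnDisc c) {z : ℂ} (hz : ‖z‖ < 1) :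
    HasDerivAt (pSum c) (∑' n, c n * (n * z ^ (n - 1))) z := by
  obtain ⟨r, hzr, hr1⟩ := exists_between hz
  have hr0 : 0 < r := (norm_nonneg z).trans_lt hzr
  have hu : Summable fun n : ℕ => (‖(n : ℂ) * c n‖ * r ^ n) * r⁻¹ :=
    (hc.natCast_mul r hr0.le hr1).mul_right _
  refine hasDerivAt_tsum_of_isPreconnected (t := ball 0 r) (y₀ := 0) hu isOpen_ball
    (convex_ball 0 r).isPreconnected (fun n y _ => (hasDerivAt_pow n y).const_mul (c n))
    (fun n y hy => ?_) (mem_ball_self hr0) (hc.hasSum (by simp)).summable (by simpa using hzr)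
  have hy' : ‖y‖ ≤ r := by simpa using (mem_ball_zero_iff.1 hy).le
  rcases n with _ | n
  · simp
  · simp only [norm_mul, norm_pow, Nat.add_sub_cancel, Complex.norm_natCast, pow_succ]
    have : ‖y‖ ^ n ≤ r ^ n := pow_le_pow_left₀ (norm_nonneg _) hy' n
    calc ‖c (n + 1)‖ * (((n + 1 : ℕ) : ℝ) * ‖y‖ ^ n) ≤ ‖c (n + 1)‖ * (((n + 1 : ℕ) : ℝ) * r ^ n) := by
          gcongr
      _ = _ := by field_simp

lemma differentiableOn (hc : ConvOnDisc c) : DifferentiableOn ℂ (pSum c) (ball 0 1) :=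
  fun _ hz => (hc.hasDerivAt (mem_ball_zero_iff.1 hz)).differentiableAt.differentiableWithinAt

lemma mul_deriv (hc : ConvOnDisc c) {z : ℂ} (hz : ‖z‖ < 1) :
    z * deriv (pSum c) z = pSum (fun n => n * c n) z := by
  rw [(hc.hasDerivAt hz).deriv, pSum, ← tsum_mul_left]
  congr 1 with n
  rcases n with _ | n
  · simp
  · simp only [Nat.add_sub_cancel, pow_succ]; ring

lemma deriv_id_mul (hc : ConvOnDisc c) {z : ℂ} (hz : ‖z‖ < 1) :
    deriv (fun w => w * pSum c w) z = pSum (fun n => (1 + n) * c n) z := by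
  have h := ((hasDerivAt_id z).mul (hc.hasDerivAt hz)).deriv
  have h2 := hc.mul_deriv hz
  rw [(hc.hasDerivAt hz).deriv] at h2
  have h3 : (fun n : ℕ => (1 + (n : ℂ)) * c n) = fun n : ℕ => c n + n * c n := by ext n; ring
  rw [h3, hc.pSum_add hc.natCast_mul hz, ← h2]
  simpa using! h

lemma continuousAt (hc : ConvOnDisc c) {z : ℂ} (hz : ‖z‖ < 1) : ContinuousAt (pSum c) z :=
  (hc.hasDerivAt hz).continuousAt

/-- Termwise integration of a power series against an integrable kernel. -/
lemma hasSum_integral (hc : ConvOnDisc c) {a b : ℝ} (hab : a ≤ b) {k φ : ℝ → ℂ}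
    (hk : IntervalIntegrable k volume a b) (hφ : Measurable φ)
    (hφ1 : ∀ t ∈ Set.Ioc a b, ‖φ t‖ ≤ 1) {w : ℂ} (hw : ‖w‖ < 1) :
    HasSum (fun n => c n * w ^ n * ∫ t in a..b, k t * φ t ^ n)
      (∫ t in a..b, k t * pSum c (φ t * w)) := by
  have key := intervalIntegral.hasSum_integral_of_dominated_convergence (μ := volume) (a := a)
    (b := b) (F := fun n t => c n * w ^ n * (k t * φ t ^ n))
    (f := fun t => k t * pSum c (φ t * w)) (fun n t => ‖k t‖ * (‖c n‖ * ‖w‖ ^ n)) ?_ ?_ ?_ ?_ ?_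
  · simpa only [intervalIntegral.integral_const_mul] using key
  · intro n
    have h1 : AEStronglyMeasurable k (volume.restrict (Set.uIoc a b)) := by
      rw [Set.uIoc_of_le hab]; exact hk.1.aestronglyMeasurable
    exact (h1.mul (hφ.pow_const n).aestronglyMeasurable).const_mul _
  · intro n
    refine .of_forall fun t ht => ?_
    rw [Set.uIoc_of_le hab] at ht
    have := pow_le_one₀ (n := n) (norm_nonneg _) (hφ1 t ht)
    calc ‖c n * w ^ n * (k t * φ t ^ n)‖ = ‖k t‖ * (‖c n‖ * ‖w‖ ^ n) * ‖φ t‖ ^ n := by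
          simp only [norm_mul, norm_pow]; ring
      _ ≤ ‖k t‖ * (‖c n‖ * ‖w‖ ^ n) * 1 := by gcongr
      _ = _ := mul_one _
  · exact .of_forall fun t _ => (hc ‖w‖ (norm_nonneg _) hw).mul_left _
  · simp only [tsum_mul_left]
    exact hk.norm.mul_const _
  · refine .of_forall fun t ht => ?_
    rw [Set.uIoc_of_le hab] at ht
    have hz : ‖φ t * w‖ < 1 := by
      rw [norm_mul]
      exact (mul_le_of_le_one_left (norm_nonneg _) (hφ1 t ht)).trans_lt hw
    refine ((hc.hasSum hz).mul_left (k t)).congr_fun fun n => ?_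
    rw [mul_pow]; ring

end ConvOnDisc

/-! ### Fourier integrals on circles and positivity of Hadamard products. -/

lemma integral_exp_mul_I_pow (m n : ℕ) :
    ∫ θ in (0 : ℝ)..2 * Real.pi,
      Complex.exp (-(θ * Complex.I)) ^ n * Complex.exp (θ * Complex.I) ^ m =
      if m = n then 2 * Real.pi else 0 := by
  have h : ∀ θ : ℝ, Complex.exp (-(θ * Complex.I)) ^ n * Complex.exp (θ * Complex.I) ^ m =
      Complex.exp ((((m : ℂ) - n) * Complex.I) * θ) := by
    intro θ
    rw [← Complex.exp_nat_mul, ← Complex.exp_nat_mul, ← Complex.exp_add]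
    congr 1; ring
  simp only [h]
  split_ifs with hmn
  · simp [hmn]
  · have hne : ((m : ℂ) - n) * Complex.I ≠ 0 := by
      refine mul_ne_zero (sub_ne_zero.2 ?_) Complex.I_ne_zero
      exact_mod_cast hmn
    rw [integral_exp_mul_complex hne]
    have : Complex.exp (((m : ℂ) - n) * Complex.I * ((2 * Real.pi : ℝ) : ℂ)) = 1 := by
      rw [Complex.exp_eq_one_iff]
      exact ⟨(m : ℤ) - n, by push_cast; ring⟩
    rw [this]; simp

lemma integral_exp_mul_I_pow_mul_pSum {P : ℕ → ℂ} (hP : ConvOnDisc P) {ρ : ℝ} (hρ0 : 0 ≤ ρ)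
    (hρ1 : ρ < 1) (n : ℕ) :
    ∫ θ in (0 : ℝ)..2 * Real.pi, Complex.exp (-(θ * Complex.I)) ^ n *
      pSum P (Complex.exp (θ * Complex.I) * ρ) = 2 * Real.pi * (P n * ρ ^ n) := by
  have h := hP.hasSum_integral (a := 0) (b := 2 * Real.pi) (by positivity)
    (k := fun θ => Complex.exp (-(θ * Complex.I)) ^ n)
    (φ := fun θ => Complex.exp (θ * Complex.I)) (w := ρ)
    (Continuous.intervalIntegrable (by fun_prop) _ _) (by fun_prop)
    (fun t _ => (Complex.norm_exp_ofReal_mul_I t).le) (by simpa [abs_of_nonneg hρ0] using hρ1)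
  simp only [integral_exp_mul_I_pow] at h
  refine h.unique ?_
  convert hasSum_ite_eq n (2 * Real.pi * (P n * (ρ : ℂ) ^ n)) using 2 with m
  split_ifs with hm
  · subst hm; push_cast; ring
  · simp

/-- Conjugation turns nonnegative frequencies into nonpositive ones, so only the constant term can
survive. -/
lemma integral_exp_mul_I_pow_mul_conj_pSum {P : ℕ → ℂ} (hP : ConvOnDisc P) {ρ : ℝ} (hρ0 : 0 ≤ ρ)
    (hρ1 : ρ < 1) (n : ℕ) :
    ∫ θ in (0 : ℝ)..2 * Real.pi, Complex.exp (-(θ * Complex.I)) ^ n *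
      (starRingEnd ℂ) (pSum P (Complex.exp (θ * Complex.I) * ρ)) =
      if n = 0 then 2 * Real.pi * (starRingEnd ℂ) (P 0) else 0 := by
  have h := hP.hasSum_integral (a := 0) (b := 2 * Real.pi) (by positivity)
    (k := fun θ => Complex.exp (θ * Complex.I) ^ n)
    (φ := fun θ => Complex.exp (θ * Complex.I)) (w := ρ)
    (Continuous.intervalIntegrable (by fun_prop) _ _) (by fun_prop)
    (fun t _ => (Complex.norm_exp_ofReal_mul_I t).le) (by simpa [abs_of_nonneg hρ0] using hρ1)
  have h2 : ∀ m : ℕ, ∫ θ in (0 : ℝ)..2 * Real.pi, Complex.exp (θ * Complex.I) ^ n *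
      Complex.exp (θ * Complex.I) ^ m = if m = 0 then (if n = 0 then 2 * Real.pi else 0) else 0 := by
    intro m
    have := integral_exp_mul_I_pow (m + n) 0
    simp only [pow_zero, one_mul] at this
    simp only [← pow_add, add_comm n m, this]
    by_cases hm : m = 0 <;> by_cases hn : n = 0 <;> simp [hm, hn]
  simp only [h2] at h
  have h3 : ∫ θ in (0 : ℝ)..2 * Real.pi, Complex.exp (θ * Complex.I) ^ n *
      pSum P (Complex.exp (θ * Complex.I) * ρ) = if n = 0 then 2 * Real.pi * P 0 else 0 := by
    refine h.unique ?_
    convert hasSum_ite_eq 0 (if n = 0 then 2 * Real.pi * P 0 else 0) using 2 with m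
    split_ifs with hm
    · subst hm; simp; ring
    · simp
    · simp
  have h4 : ∀ θ : ℝ, Complex.exp (-(θ * Complex.I)) ^ n *
      (starRingEnd ℂ) (pSum P (Complex.exp (θ * Complex.I) * ρ)) =
      (starRingEnd ℂ) (Complex.exp (θ * Complex.I) ^ n *
        pSum P (Complex.exp (θ * Complex.I) * ρ)) := by
    intro θ
    rw [map_mul, map_pow, ← Complex.exp_conj]
    simp
  simp only [h4]
  rw [intervalIntegral.intervalIntegral_conj, h3]
  split_ifs
  · simp [Complex.conj_ofReal, Complex.conj_ofNat]
  · simp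

/-- The `n`-th Fourier moment of `Re P` is `π Pₙ ρⁿ`, plus an extra `π * conj P₀` when `n = 0`.
Subtracting `1/2` from `Re s`, where `s 0 = 1`, cancels that extra term after taking real parts. -/
lemma integral_re_mul_re_pSum {P s : ℕ → ℂ} (hP : ConvOnDisc P) (hs : ConvOnDisc s)
    (hs0 : s 0 = 1) {ρ : ℝ} (hρ0 : 0 < ρ) (hρ1 : ρ < 1) {w : ℂ} (hw : ‖w‖ < 1) :
    ∫ θ in (0 : ℝ)..2 * Real.pi, (pSum P (Complex.exp (θ * Complex.I) * ρ)).re *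
      ((pSum s (Complex.exp (-(θ * Complex.I)) * w)).re - 1 / 2) =
      Real.pi * (pSum (fun n => P n * s n) (ρ * w)).re := by
  have hρ : ∀ θ : ℝ, ‖Complex.exp (θ * Complex.I) * ρ‖ < 1 := fun θ => by
    simpa [Complex.norm_exp_ofReal_mul_I, abs_of_pos hρ0] using hρ1
  have hφ1 : ∀ θ : ℝ, ‖Complex.exp (-(θ * Complex.I))‖ = 1 := fun θ => by
    have := Complex.norm_exp_ofReal_mul_I (-θ)
    simpa using this
  have hw' : ∀ θ : ℝ, ‖Complex.exp (-(θ * Complex.I)) * w‖ < 1 := fun θ => by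
    rw [norm_mul, hφ1, one_mul]; exact hw
  have hp : Continuous fun θ : ℝ => pSum P (Complex.exp (θ * Complex.I) * ρ) :=
    continuous_iff_continuousAt.2 fun θ =>
      (hP.continuousAt (hρ θ)).comp (f := fun θ : ℝ => Complex.exp (θ * Complex.I) * ρ)
        (by fun_prop)
  have hσ : Continuous fun θ : ℝ => pSum s (Complex.exp (-(θ * Complex.I)) * w) :=
    continuous_iff_continuousAt.2 fun θ =>
      (hs.continuousAt (hw' θ)).comp (f := fun θ : ℝ => Complex.exp (-(θ * Complex.I)) * w)
        (by fun_prop)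
  have hk : Continuous fun θ : ℝ => ((pSum P (Complex.exp (θ * Complex.I) * ρ)).re : ℂ) :=
    Complex.continuous_ofReal.comp (Complex.continuous_re.comp hp)
  have hmom : ∀ n : ℕ, ∫ θ in (0 : ℝ)..2 * Real.pi,
      ((pSum P (Complex.exp (θ * Complex.I) * ρ)).re : ℂ) * Complex.exp (-(θ * Complex.I)) ^ n =
      Real.pi * (P n * ρ ^ n) + if n = 0 then Real.pi * (starRingEnd ℂ) (P 0) else 0 := by
    intro n
    have e : ∀ θ : ℝ, ((pSum P (Complex.exp (θ * Complex.I) * ρ)).re : ℂ) *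
        Complex.exp (-(θ * Complex.I)) ^ n =
        2⁻¹ * (Complex.exp (-(θ * Complex.I)) ^ n * pSum P (Complex.exp (θ * Complex.I) * ρ) +
        Complex.exp (-(θ * Complex.I)) ^ n *
          (starRingEnd ℂ) (pSum P (Complex.exp (θ * Complex.I) * ρ))) := by
      intro θ
      rw [Complex.re_eq_add_conj]; ring
    simp only [e]
    rw [intervalIntegral.integral_const_mul, intervalIntegral.integral_add,
      integral_exp_mul_I_pow_mul_pSum hP hρ0.le hρ1,
      integral_exp_mul_I_pow_mul_conj_pSum hP hρ0.le hρ1]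
    · split_ifs <;> ring
    · exact Continuous.intervalIntegrable (by fun_prop) _ _
    · exact Continuous.intervalIntegrable
        ((by fun_prop : Continuous fun θ : ℝ => Complex.exp (-(θ * Complex.I)) ^ n).mul
          (Complex.continuous_conj.comp hp)) _ _
  have h := hs.hasSum_integral (a := 0) (b := 2 * Real.pi) (by positivity)
    (hk.intervalIntegrable _ _) (φ := fun θ => Complex.exp (-(θ * Complex.I))) (by fun_prop)
    (fun t _ => (hφ1 t).le) hw
  simp only [hmom] at h
  -- The radius is split as `√r * √r`, one factor for each series.
  have hPs : ConvOnDisc fun n => P n * s n := by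
    intro r hr0 hr1
    have hr2 : Real.sqrt r < 1 := by
      rw [Real.sqrt_lt' one_pos]; simpa using hr1
    have h1 := hP _ (Real.sqrt_nonneg r) hr2
    have h2 := hs _ (Real.sqrt_nonneg r) hr2
    obtain ⟨C, hC⟩ := h1.tendsto_atTop_zero.bddAbove_range
    refine Summable.of_nonneg_of_le (fun n => by positivity) (fun n => ?_) (h2.mul_left C)
    have h3 : ‖P n‖ * Real.sqrt r ^ n ≤ C := hC ⟨n, rfl⟩
    calc ‖P n * s n‖ * r ^ n = (‖P n‖ * Real.sqrt r ^ n) * (‖s n‖ * Real.sqrt r ^ n) := by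
          nth_rw 1 [← Real.mul_self_sqrt hr0]
          rw [norm_mul, mul_pow]; ring
      _ ≤ C * (‖s n‖ * Real.sqrt r ^ n) := by gcongr
  have hρw : ‖(ρ : ℂ) * w‖ < 1 := by
    rw [norm_mul, Complex.norm_real, Real.norm_of_nonneg hρ0.le]
    nlinarith [norm_nonneg w]
  have h5 : ∫ θ in (0 : ℝ)..2 * Real.pi, ((pSum P (Complex.exp (θ * Complex.I) * ρ)).re : ℂ) *
      pSum s (Complex.exp (-(θ * Complex.I)) * w) =
      Real.pi * pSum (fun n => P n * s n) (ρ * w) + Real.pi * (starRingEnd ℂ) (P 0) := by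
    refine h.unique ?_
    refine (((hPs.hasSum hρw).mul_left (Real.pi : ℂ)).add
      (hasSum_ite_eq 0 (Real.pi * (starRingEnd ℂ) (P 0)))).congr_fun fun n => ?_
    split_ifs with hn
    · subst hn; simp [hs0]
    · rw [mul_pow]; ring
  have h6 := hmom 0
  simp only [pow_zero, mul_one, if_true] at h6
  have hI1 : IntervalIntegrable (fun θ : ℝ => ((pSum P (Complex.exp (θ * Complex.I) * ρ)).re : ℂ) *
      pSum s (Complex.exp (-(θ * Complex.I)) * w)) volume 0 (2 * Real.pi) :=
    (hk.mul hσ).intervalIntegrable _ _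
  have hI2 : IntervalIntegrable (fun θ : ℝ =>
      ((pSum P (Complex.exp (θ * Complex.I) * ρ)).re : ℂ) * 2⁻¹) volume 0 (2 * Real.pi) :=
    (hk.mul continuous_const).intervalIntegrable _ _
  have h7 : ∫ θ in (0 : ℝ)..2 * Real.pi, (((pSum P (Complex.exp (θ * Complex.I) * ρ)).re : ℂ) *
      pSum s (Complex.exp (-(θ * Complex.I)) * w) -
      ((pSum P (Complex.exp (θ * Complex.I) * ρ)).re : ℂ) * 2⁻¹) =
      Real.pi * pSum (fun n => P n * s n) (ρ * w) + Real.pi * (starRingEnd ℂ) (P 0) -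
      (Real.pi * P 0 + Real.pi * (starRingEnd ℂ) (P 0)) * 2⁻¹ := by
    rw [intervalIntegral.integral_sub hI1 hI2,
      intervalIntegral.integral_mul_const, h5, h6]
  have h8 := congrArg Complex.re h7
  have h9 := intervalIntegral.intervalIntegral_re (𝕜 := ℂ) (hI1.sub hI2)
  simp only [RCLike.re_eq_complex_re] at h9
  rw [← h9] at h8
  have h10 : (Real.pi * pSum (fun n => P n * s n) (ρ * w) + Real.pi * (starRingEnd ℂ) (P 0) -
      (Real.pi * P 0 + Real.pi * (starRingEnd ℂ) (P 0)) * 2⁻¹).re =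
      Real.pi * (pSum (fun n => P n * s n) (ρ * w)).re := by
    have : ((2 : ℂ)⁻¹) = ((2⁻¹ : ℝ) : ℂ) := by push_cast; rfl
    rw [this]
    simp only [Complex.sub_re, Complex.add_re, Complex.re_ofReal_mul, Complex.re_mul_ofReal,
      Complex.conj_re]
    ring
  rw [h10] at h8
  rw [← h8]
  refine intervalIntegral.integral_congr fun θ _ => ?_
  have : ((2 : ℂ)⁻¹) = ((2⁻¹ : ℝ) : ℂ) := by push_cast; rfl
  simp only [this, Complex.sub_re, Complex.re_ofReal_mul, Complex.ofReal_re]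
  ring

/-- Convolution of a power series with positive real part and one with real part at least `1/2`. -/
lemma re_pSum_mul_pos {P s : ℕ → ℂ} (hP : ConvOnDisc P) (hs : ConvOnDisc s) (hs0 : s 0 = 1)
    (h1 : ∀ z : ℂ, ‖z‖ < 1 → 0 < (pSum P z).re)
    (h2 : ∀ w : ℂ, ‖w‖ < 1 → 1 / 2 ≤ (pSum s w).re) {z : ℂ} (hz : ‖z‖ < 1) :
    0 < (pSum (fun n => P n * s n) z).re := by
  obtain ⟨ρ, hzρ, hρ1⟩ := exists_between hz
  have hρ0 : 0 < ρ := (norm_nonneg z).trans_lt hzρ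
  have hw : ‖z / ρ‖ < 1 := by
    rw [norm_div, Complex.norm_real, Real.norm_of_nonneg hρ0.le]
    exact (div_lt_one hρ0).2 hzρ
  have hzw : (ρ : ℂ) * (z / ρ) = z := mul_div_cancel₀ _ (by exact_mod_cast hρ0.ne')
  have hρ : ∀ θ : ℝ, ‖Complex.exp (θ * Complex.I) * ρ‖ < 1 := fun θ => by
    simpa [Complex.norm_exp_ofReal_mul_I, abs_of_pos hρ0] using hρ1
  have hw' : ∀ θ : ℝ, ‖Complex.exp (-(θ * Complex.I)) * (z / ρ)‖ < 1 := fun θ => by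
    have := Complex.norm_exp_ofReal_mul_I (-θ)
    rw [norm_mul, ← neg_mul, ← Complex.ofReal_neg, this, one_mul]; exact hw
  have hp : Continuous fun θ : ℝ => (pSum P (Complex.exp (θ * Complex.I) * ρ)).re :=
    Complex.continuous_re.comp <| continuous_iff_continuousAt.2 fun θ =>
      (hP.continuousAt (hρ θ)).comp (f := fun θ : ℝ => Complex.exp (θ * Complex.I) * ρ)
        (by fun_prop)
  have hσ : Continuous fun θ : ℝ => (pSum s (Complex.exp (-(θ * Complex.I)) * (z / ρ))).re :=
    Complex.continuous_re.comp <| continuous_iff_continuousAt.2 fun θ =>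
      (hs.continuousAt (hw' θ)).comp (f := fun θ : ℝ => Complex.exp (-(θ * Complex.I)) * (z / ρ))
        (by fun_prop)
  obtain ⟨θ₀, -, hθ₀⟩ := isCompact_Icc.exists_isMinOn
    (Set.nonempty_Icc.2 (by positivity : (0 : ℝ) ≤ 2 * Real.pi)) hp.continuousOn
  set δ := (pSum P (Complex.exp (θ₀ * Complex.I) * ρ)).re with hδ
  have hδ0 : 0 < δ := h1 _ (hρ θ₀)
  -- Comparison with the constant series `δ`, the minimum of `Re P` on the circle, gives strict
  -- positivity although `Re s - 1/2` may vanish: the product of `D` and `s` is `δ` itself.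
  let D : ℕ → ℂ := fun n => if n = 0 then (δ : ℂ) else 0
  have hDz : ∀ u : ℂ, HasSum (fun n => D n * u ^ n) δ := fun u => by
    convert hasSum_ite_eq 0 (δ : ℂ) using 2 with n
    by_cases hn : n = 0 <;> simp [D, hn]
  have hD : ConvOnDisc D := .of_summable fun u _ => (hDz u).summable
  have hDs : pSum (fun n => D n * s n) z = δ := by
    refine HasSum.tsum_eq ?_
    convert hasSum_ite_eq 0 (δ : ℂ) using 2 with n
    by_cases hn : n = 0 <;> simp [D, hn, hs0]
  have e1 := integral_re_mul_re_pSum hP hs hs0 hρ0 hρ1 hw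
  have e2 := integral_re_mul_re_pSum hD hs hs0 hρ0 hρ1 hw
  rw [hzw] at e1 e2
  rw [hDs] at e2
  simp only [fun u => show pSum D u = δ from (hDz u).tsum_eq, Complex.ofReal_re] at e2
  have hle : Real.pi * δ ≤ Real.pi * (pSum (fun n => P n * s n) z).re := by
    rw [← e1, ← e2]
    refine intervalIntegral.integral_mono_on (by positivity)
      (Continuous.intervalIntegrable (by fun_prop) _ _)
      (Continuous.intervalIntegrable (by fun_prop) _ _) fun θ hθ => ?_
    have := h2 _ (hw' θ)
    exact mul_le_mul_of_nonneg_right (hθ₀ hθ) (by linarith)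
  exact hδ0.trans_le (le_of_mul_le_mul_left hle Real.pi_pos)

/-! ### The integral inequality for the starlikeness kernel. -/

/-- The properties of a weight on `(0, 1)` that make it admissible; the derivative condition says
that `t ↦ lam t / (1 - t ^ 2)` is decreasing. -/
structure Admissible (lam : ℝ → ℝ) : Prop where
  integrable : IntervalIntegrable lam volume 0 1
  nonneg : ∀ t ∈ Set.Ioo (0 : ℝ) 1, 0 ≤ lam t
  integral_eq : ∫ t in (0 : ℝ)..1, lam t = 1
  continuousOn : ContinuousOn (fun t => t ^ 2 * lam t) (Set.Icc 0 1)
  map_one : lam 1 = 0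
  deriv_le : ∀ t ∈ Set.Ioo (0 : ℝ) 1, ∃ l', HasDerivAt lam l' t ∧ l' * (1 - t ^ 2) + 2 * t * lam t ≤ 0

/-- The auxiliary function whose product with the weight is a lower primitive. -/
noncomputable def lowerPrim (r e t : ℝ) : ℝ :=
  (r + e) / 2 * ((1 - r * t) / ((1 + r * t) * (1 - 2 * t * e + t ^ 2 * r ^ 2)))

/-- For `r = |w|` and `e = Re w` this is `|1 - t w|²`; it is at least `(1 - t r)²`. -/
lemma quad_pos {r e t : ℝ} (hr0 : 0 ≤ r) (hr1 : r < 1) (he : e ≤ r) (ht0 : 0 ≤ t)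
    (ht1 : t ≤ 1) : 0 < 1 - 2 * t * e + t ^ 2 * r ^ 2 := by
  have h1 : t * r < 1 := by nlinarith
  nlinarith [mul_le_mul_of_nonneg_left he ht0, sq_pos_of_pos (sub_pos.2 h1)]

lemma hasDerivAt_sq_mul_lowerPrim {r e t : ℝ} (hr0 : 0 ≤ r) (hr1 : r < 1) (he : e ≤ r)
    (ht0 : 0 < t) (ht1 : t < 1) :
    HasDerivAt (fun t => t ^ 2 * lowerPrim r e t)
      (((r + e) / 2) * ((2 * t - 3 * r * t ^ 2) / ((1 + r * t) * (1 - 2 * t * e + t ^ 2 * r ^ 2)) -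
        t ^ 2 * (1 - r * t) * (r * (1 - 2 * t * e + t ^ 2 * r ^ 2) +
          (1 + r * t) * (-2 * e + 2 * t * r ^ 2)) /
          ((1 + r * t) * (1 - 2 * t * e + t ^ 2 * r ^ 2)) ^ 2)) t := by
  have hd := quad_pos hr0 hr1 he ht0.le ht1.le
  have h1 : 0 < 1 + r * t := by positivity
  have hne : (1 + r * t) * (1 - 2 * t * e + t ^ 2 * r ^ 2) ≠ 0 := by positivity
  have hi := hasDerivAt_id t
  have e1 : HasDerivAt (fun t : ℝ => 1 - r * t) (-r) t := by
    simpa using (hi.const_mul r).const_sub 1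
  have e2 : HasDerivAt (fun t : ℝ => 1 + r * t) r t := by
    simpa using (hi.const_mul r).const_add 1
  have e3 : HasDerivAt (fun t : ℝ => 1 - 2 * t * e + t ^ 2 * r ^ 2) (-2 * e + 2 * t * r ^ 2) t := by
    have := (((hi.const_mul 2).mul_const e).const_sub 1).add ((hasDerivAt_pow 2 t).mul_const (r ^ 2))
    convert! this using 1
    simp
  have e4 : HasDerivAt (fun t : ℝ => t ^ 2) (2 * t) t := by simpa using hasDerivAt_pow 2 t
  have := e4.mul ((e1.div (e2.mul e3) hne).const_mul ((r + e) / 2))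
  refine this.congr_deriv ?_
  simp only [Pi.mul_apply, Pi.div_apply]
  field_simp
  ring

/-- The right side minus the left is exactly `(r + e) t (1 - r t)² / (2 (1 + r t)² D)`, with `D` the
quadratic of `quad_pos`. -/
lemma lowerPrim_ineq {r e t : ℝ} (hr0 : 0 ≤ r) (hr1 : r < 1) (he : e ≤ r) (he' : -r ≤ e)
    (ht0 : 0 < t) (ht1 : t < 1) :
    (((r + e) / 2) * ((2 * t - 3 * r * t ^ 2) / ((1 + r * t) * (1 - 2 * t * e + t ^ 2 * r ^ 2)) -
        t ^ 2 * (1 - r * t) * (r * (1 - 2 * t * e + t ^ 2 * r ^ 2) +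
          (1 + r * t) * (-2 * e + 2 * t * r ^ 2)) /
          ((1 + r * t) * (1 - 2 * t * e + t ^ 2 * r ^ 2)) ^ 2)) -
      2 * r ^ 2 * t / (1 - r ^ 2 * t ^ 2) * (t ^ 2 * lowerPrim r e t) ≤
    (1 - t * e) / (1 - 2 * t * e + t ^ 2 * r ^ 2) +
      (t * e * (1 + t ^ 2 * r ^ 2) - 2 * (t ^ 2 * r ^ 2)) /
        (2 * (1 - 2 * t * e + t ^ 2 * r ^ 2) ^ 2) -
      t * r / (2 * (1 - 2 * t * e + t ^ 2 * r ^ 2)) - 1 / (1 + t * r) ^ 2 := by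
  have hd := quad_pos hr0 hr1 he ht0.le ht1.le
  have h1 : 0 < 1 + r * t := by positivity
  have h1' : 0 < 1 - r * t := by nlinarith
  have h2 : 1 - r ^ 2 * t ^ 2 = (1 - r * t) * (1 + r * t) := by ring
  have h3 : 1 + t * r = 1 + r * t := by ring
  have h0 : 0 ≤ (r + e) * t * (1 - r * t) ^ 2 /
      (2 * (1 + r * t) ^ 2 * (1 - 2 * t * e + t ^ 2 * r ^ 2)) := by
    have : 0 ≤ r + e := by linarith
    positivity
  rw [← sub_nonneg]
  convert h0 using 1
  rw [h2, h3, lowerPrim]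
  generalize hD : 1 - 2 * t * e + t ^ 2 * r ^ 2 = D at *
  -- Eliminating `e` in favour of `D` makes the identity rational in `t`, `r`, `D` with simple
  -- denominators.
  have he2 : e = (1 + t ^ 2 * r ^ 2 - D) / (2 * t) := by field_simp; linarith
  rw [he2]
  have hne : 1 - t * r ≠ 0 := by rw [mul_comm]; exact h1'.ne'
  simp only [mul_comm r t] at *
  field_simp
  ring

/-- The part of the kernel linear in `x` is bounded below by minus its modulus, which removes `x`
and leaves a function of `|w|` and `Re w`. -/
lemma re_kernel_ge {w x : ℂ} (hw : ‖w‖ < 1) (hx : ‖x‖ = 1) {t : ℝ} (ht0 : 0 < t) (ht1 : t < 1) :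
    (1 - t * w.re) / (1 - 2 * t * w.re + t ^ 2 * ‖w‖ ^ 2) +
      (t * w.re * (1 + t ^ 2 * ‖w‖ ^ 2) - 2 * (t ^ 2 * ‖w‖ ^ 2)) /
        (2 * (1 - 2 * t * w.re + t ^ 2 * ‖w‖ ^ 2) ^ 2) -
      t * ‖w‖ / (2 * (1 - 2 * t * w.re + t ^ 2 * ‖w‖ ^ 2)) ≤
    (1 / (1 - t * w) + (1 + x) / 2 * (t * w / (1 - t * w) ^ 2)).re := by
  have hd := quad_pos (norm_nonneg w) hw (Complex.re_le_norm w) ht0.le ht1.le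
  have hn : ‖w‖ ^ 2 = w.re ^ 2 + w.im ^ 2 := by
    rw [Complex.sq_norm, Complex.normSq_apply]; ring
  have hN : Complex.normSq (1 - t * w) = 1 - 2 * t * w.re + t ^ 2 * ‖w‖ ^ 2 := by
    rw [hn, Complex.normSq_apply]; simp; ring
  have hne : (1 : ℂ) - t * w ≠ 0 := by
    rw [← Complex.normSq_pos, hN]; exact hd
  have hA : (1 / (1 - t * w)).re = (1 - t * w.re) / (1 - 2 * t * w.re + t ^ 2 * ‖w‖ ^ 2) := by
    rw [one_div, Complex.inv_re, hN]; simp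
  have hB : (t * w / (1 - t * w) ^ 2).re =
      (t * w.re * (1 + t ^ 2 * ‖w‖ ^ 2) - 2 * (t ^ 2 * ‖w‖ ^ 2)) /
        (1 - 2 * t * w.re + t ^ 2 * ‖w‖ ^ 2) ^ 2 := by
    rw [Complex.div_re, map_pow, hN, hn, ← add_div]
    congr 1
    simp [pow_two]
    ring
  have hC : ‖t * w / (1 - t * w) ^ 2‖ = t * ‖w‖ / (1 - 2 * t * w.re + t ^ 2 * ‖w‖ ^ 2) := by
    rw [norm_div, norm_pow, Complex.sq_norm, hN, norm_mul, Complex.norm_real,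
      Real.norm_of_nonneg ht0.le]
  have hD : -(t * ‖w‖ / (1 - 2 * t * w.re + t ^ 2 * ‖w‖ ^ 2)) ≤
      (x * (t * w / (1 - t * w) ^ 2)).re := by
    rw [← hC]
    have := Complex.abs_re_le_norm (x * (t * w / (1 - t * w) ^ 2))
    rw [norm_mul, hx, one_mul] at this
    exact (abs_le.1 this).1
  have hE : (1 / (1 - t * w) + (1 + x) / 2 * (t * w / (1 - t * w) ^ 2)).re =
      (1 / (1 - t * w)).re + ((t * w / (1 - t * w) ^ 2).re +
        (x * (t * w / (1 - t * w) ^ 2)).re) / 2 := by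
    have : 1 / (1 - t * w) + (1 + x) / 2 * (t * w / (1 - t * w) ^ 2) =
      1 / (1 - t * w) + ((2⁻¹ : ℝ) : ℂ) * (t * w / (1 - t * w) ^ 2 +
        x * (t * w / (1 - t * w) ^ 2)) := by push_cast; ring
    rw [this, Complex.add_re, Complex.re_ofReal_mul, Complex.add_re]
    ring
  rw [hE, hA, hB]
  rw [mul_comm 2 ((_ : ℝ) ^ 2), mul_comm 2 (1 - 2 * t * w.re + _), ← div_div, ← div_div]
  linarith

/-- With `ψ = t ^ 2 * lowerPrim`, the function `lam * ψ` vanishes at both ends and its derivative is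
at most the integrand. This uses `ψ ≥ 0` and the logarithmic decay of `lam` encoded in `Admissible`.
-/
lemma integral_weight_kernel_nonneg {lam : ℝ → ℝ} (hl : Admissible lam) {w x : ℂ} (hw : ‖w‖ < 1)
    (hx : ‖x‖ = 1) (hint : IntervalIntegrable (fun t : ℝ => lam t *
      ((1 / (1 - t * w) + (1 + x) / 2 * (t * w / (1 - t * w) ^ 2)).re - 1 / (1 + t * ‖w‖) ^ 2))
      volume 0 1) :
    0 ≤ ∫ t in (0 : ℝ)..1, lam t *
      ((1 / (1 - t * w) + (1 + x) / 2 * (t * w / (1 - t * w) ^ 2)).re - 1 / (1 + t * ‖w‖) ^ 2) := by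
  have hr0 := norm_nonneg w
  have he := Complex.re_le_norm w
  have he' : -‖w‖ ≤ w.re := (abs_le.1 (Complex.abs_re_le_norm w)).1
  set r := ‖w‖
  set e := w.re
  choose! l' hl' hle using hl.deriv_le
  have hcont : ContinuousOn (fun t => lam t * (t ^ 2 * lowerPrim r e t)) (Set.Icc 0 1) := by
    have h2 : ContinuousOn (lowerPrim r e) (Set.Icc 0 1) := by
      unfold lowerPrim
      refine ContinuousOn.mul continuousOn_const (ContinuousOn.div (by fun_prop) (by fun_prop) ?_)
      intro t ht
      have := quad_pos hr0 hw he ht.1 ht.2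
      have h1 : 0 < 1 + r * t := by have := ht.1; positivity
      positivity
    refine (hl.continuousOn.mul h2).congr fun t _ => ?_
    simp only [Pi.mul_apply]
    ring
  -- This one-sided form of the fundamental theorem needs no integrability of the derivative of `lam
  -- * ψ`.
  have key := intervalIntegral.sub_le_integral_of_hasDeriv_right_of_le zero_le_one hcont
    (fun t ht => ((hl' t ht).mul
      (hasDerivAt_sq_mul_lowerPrim hr0 hw he ht.1 ht.2)).hasDerivWithinAt)
    ((intervalIntegrable_iff_integrableOn_Icc_of_le zero_le_one).1 hint) ?_
  · simpa [hl.map_one] using key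
  · intro t ht
    have h1 := lowerPrim_ineq hr0 hw he he' ht.1 ht.2
    have h2 := re_kernel_ge hw hx ht.1 ht.2
    have h3 := hl.nonneg t ht
    have h4 := hle t ht
    have hrt : r * t < 1 := by nlinarith [ht.1, ht.2]
    have hrt0 : 0 ≤ r * t := mul_nonneg hr0 ht.1.le
    have hψ : 0 ≤ t ^ 2 * lowerPrim r e t := by
      unfold lowerPrim
      have := quad_pos hr0 hw he ht.1.le ht.2.le
      have h5 : 0 ≤ r + e := by linarith
      have h6 : 0 ≤ 1 - r * t := by linarith
      positivity
    have hden : 0 < 1 - r ^ 2 * t ^ 2 := by nlinarith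
    have hden' : 0 < 1 - t ^ 2 := by nlinarith [ht.1, ht.2]
    -- The decay rate `2t / (1 - t²)` from admissibility dominates the rate `2r²t / (1 - r²t²)`
    -- required by `lowerPrim_ineq`, since `r < 1`.
    have h7 : l' t ≤ -(2 * r ^ 2 * t / (1 - r ^ 2 * t ^ 2) * lam t) := by
      have h8 : l' t ≤ -(2 * t / (1 - t ^ 2) * lam t) := by
        rw [div_mul_eq_mul_div, ← neg_div, le_div_iff₀ hden']; linarith
      have h9 : 2 * r ^ 2 * t / (1 - r ^ 2 * t ^ 2) ≤ 2 * t / (1 - t ^ 2) := by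
        rw [div_le_div_iff₀ hden hden']
        have : r ^ 2 ≤ 1 := by nlinarith
        nlinarith [ht.1, mul_nonneg ht.1.le (sub_nonneg.2 this)]
      have := mul_le_mul_of_nonneg_right h9 h3
      linarith
    have h10 := mul_le_mul_of_nonneg_right h7 hψ
    have h11 := mul_le_mul_of_nonneg_left (h1.trans (sub_le_sub_right h2 _)) h3
    refine le_trans ?_ h11
    rw [mul_sub]
    linarith

/-! ### Moments, and averages over `t ^ ν`, acting on coefficients. -/

/-- The moments `∫₀¹ lam t * t ^ n`. -/
noncomputable def moment (lam : ℝ → ℝ) (n : ℕ) : ℝ := ∫ t in (0 : ℝ)..1, lam t * t ^ n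

lemma norm_moment_le {lam : ℝ → ℝ} (hl : IntervalIntegrable lam volume 0 1) (n : ℕ) :
    ‖(moment lam n : ℂ)‖ ≤ ∫ t in (0 : ℝ)..1, ‖lam t‖ := by
  rw [Complex.norm_real]
  refine intervalIntegral.norm_integral_le_of_norm_le zero_le_one (.of_forall fun t ht => ?_) hl.norm
  rw [norm_mul, norm_pow]
  refine mul_le_of_le_one_right (norm_nonneg _) (pow_le_one₀ (norm_nonneg _) ?_)
  rw [Real.norm_of_nonneg ht.1.le]; exact ht.2

lemma norm_ofReal_mul_lt {t : ℝ} (h0 : 0 ≤ t) (h1 : t ≤ 1) {w : ℂ} (hw : ‖w‖ < 1) :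
    ‖(t : ℂ) * w‖ < 1 := by
  rw [norm_mul, Complex.norm_real, Real.norm_of_nonneg h0]
  exact (mul_le_of_le_one_left (norm_nonneg _) h1).trans_lt hw

namespace ConvOnDisc

variable {c d : ℕ → ℂ}

lemma moment_mul (hc : ConvOnDisc c) {lam : ℝ → ℝ} (hl : IntervalIntegrable lam volume 0 1) :
    ConvOnDisc fun n => moment lam n * c n :=
  hc.mul_of_bounded _ (norm_moment_le hl)

lemma continuousOn_comp (hc : ConvOnDisc c) {φ : ℝ → ℝ} (hφ : ContinuousOn φ (Set.Icc 0 1))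
    (hφ1 : ∀ t ∈ Set.Icc (0 : ℝ) 1, φ t ∈ Set.Icc (0 : ℝ) 1) {w : ℂ} (hw : ‖w‖ < 1) :
    ContinuousOn (fun t => pSum c (φ t * w)) (Set.Icc 0 1) := by
  refine hc.differentiableOn.continuousOn.comp (t := ball 0 1)
    (f := fun t : ℝ => (φ t : ℂ) * w) ?_ fun t ht => ?_
  · exact (Complex.continuous_ofReal.comp_continuousOn hφ).mul continuousOn_const
  · exact mem_ball_zero_iff.2 (norm_ofReal_mul_lt (hφ1 t ht).1 (hφ1 t ht).2 hw)

lemma continuousOn_comp_mul (hc : ConvOnDisc c) {w : ℂ} (hw : ‖w‖ < 1) :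
    ContinuousOn (fun t : ℝ => pSum c (t * w)) (Set.Icc 0 1) :=
  hc.continuousOn_comp continuousOn_id (fun _ h => h) hw

lemma integral_weight_mul_pSum (hc : ConvOnDisc c) {lam : ℝ → ℝ}
    (hl : IntervalIntegrable lam volume 0 1) {w : ℂ} (hw : ‖w‖ < 1) :
    ∫ t in (0 : ℝ)..1, (lam t : ℂ) * pSum c (t * w) = pSum (fun n => moment lam n * c n) w := by
  have h := hc.hasSum_integral zero_le_one (k := fun t => (lam t : ℂ)) ⟨hl.1.ofReal, hl.2.ofReal⟩
    (φ := fun t => (t : ℂ)) (by fun_prop) (fun t ht => by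
      rw [Complex.norm_real, Real.norm_of_nonneg ht.1.le]; exact ht.2) hw
  refine h.unique (((hc.moment_mul hl).hasSum hw).congr_fun fun n => ?_)
  have : ∫ t in (0 : ℝ)..1, (lam t : ℂ) * (t : ℂ) ^ n = moment lam n := by
    rw [moment, ← intervalIntegral.integral_ofReal]
    simp
  rw [this]; ring

lemma intervalIntegrable_weight (hc : ConvOnDisc c) {lam : ℝ → ℝ}
    (hl : IntervalIntegrable lam volume 0 1) {w : ℂ} (hw : ‖w‖ < 1) :
    IntervalIntegrable (fun t : ℝ => lam t * (pSum c (t * w)).re) volume 0 1 :=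
  hl.mul_continuousOn (by
    rw [Set.uIcc_of_le zero_le_one]
    exact Complex.continuous_re.comp_continuousOn (hc.continuousOn_comp_mul hw))

lemma integral_weight_mul_re_pSum (hc : ConvOnDisc c) {lam : ℝ → ℝ}
    (hl : IntervalIntegrable lam volume 0 1) {w : ℂ} (hw : ‖w‖ < 1) :
    ∫ t in (0 : ℝ)..1, lam t * (pSum c (t * w)).re =
      (pSum (fun n => moment lam n * c n) w).re := by
  have hi : IntervalIntegrable (fun t : ℝ => (lam t : ℂ) * pSum c (t * w)) volume 0 1 :=
    IntervalIntegrable.mul_continuousOn ⟨hl.1.ofReal, hl.2.ofReal⟩ (by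
      rw [Set.uIcc_of_le zero_le_one]; exact hc.continuousOn_comp_mul hw)
  have h := intervalIntegral.intervalIntegral_re (𝕜 := ℂ) hi
  rw [hc.integral_weight_mul_pSum hl hw] at h
  simpa only [RCLike.re_eq_complex_re, Complex.re_ofReal_mul] using h

lemma norm_one_add_mul_inv_le {ν : ℝ} (hν : 0 < ν) (n : ℕ) :
    ‖(1 + (ν : ℂ) * n)⁻¹‖ ≤ 1 := by
  have : (1 + (ν : ℂ) * n) = ((1 + ν * n : ℝ) : ℂ) := by push_cast; rfl
  rw [this, norm_inv, Complex.norm_real, Real.norm_of_nonneg (by positivity)]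
  refine inv_le_one_of_one_le₀ ?_
  have : 0 ≤ ν * n := by positivity
  linarith

lemma avg (hc : ConvOnDisc c) {ν : ℝ} (hν : 0 < ν) :
    ConvOnDisc fun n => (1 + (ν : ℂ) * n)⁻¹ * c n :=
  hc.mul_of_bounded 1 (norm_one_add_mul_inv_le hν)

lemma continuousOn_comp_rpow (hc : ConvOnDisc c) {ν : ℝ} (hν : 0 < ν) {w : ℂ} (hw : ‖w‖ < 1) :
    ContinuousOn (fun t : ℝ => pSum c ((t ^ ν : ℝ) * w)) (Set.Icc 0 1) :=
  hc.continuousOn_comp (Real.continuous_rpow_const hν.le).continuousOn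
    (fun _ h => ⟨Real.rpow_nonneg h.1 _, Real.rpow_le_one h.1 h.2 hν.le⟩) hw

lemma intervalIntegrable_re_rpow (hc : ConvOnDisc c) {ν : ℝ} (hν : 0 < ν) {w : ℂ} (hw : ‖w‖ < 1) :
    IntervalIntegrable (fun t : ℝ => (pSum c ((t ^ ν : ℝ) * w)).re) volume 0 1 :=
  ContinuousOn.intervalIntegrable (by
    rw [Set.uIcc_of_le zero_le_one]
    exact Complex.continuous_re.comp_continuousOn (hc.continuousOn_comp_rpow hν hw))

/-- Division of the `n`-th coefficient by `1 + ν n` is an average over the disc. -/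
lemma re_pSum_avg (hc : ConvOnDisc c) {ν : ℝ} (hν : 0 < ν) {w : ℂ} (hw : ‖w‖ < 1) :
    (pSum (fun n => (1 + (ν : ℂ) * n)⁻¹ * c n) w).re =
      ∫ t in (0 : ℝ)..1, (pSum c ((t ^ ν : ℝ) * w)).re := by
  have hi : IntervalIntegrable (fun t : ℝ => pSum c ((t ^ ν : ℝ) * w)) volume 0 1 :=
    ContinuousOn.intervalIntegrable (by
      rw [Set.uIcc_of_le zero_le_one]; exact hc.continuousOn_comp_rpow hν hw)
  have h := intervalIntegral.intervalIntegral_re (𝕜 := ℂ) hi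
  simp only [RCLike.re_eq_complex_re] at h
  rw [h]
  congr 1
  have h := hc.hasSum_integral zero_le_one (k := fun _ => (1 : ℂ)) (intervalIntegrable_const)
    (φ := fun t => ((t ^ ν : ℝ) : ℂ)) (by fun_prop) (fun t ht => by
      rw [Complex.norm_real, Real.norm_of_nonneg (Real.rpow_nonneg ht.1.le _)]
      exact Real.rpow_le_one ht.1.le ht.2 hν.le) hw
  simp only [one_mul] at h
  refine ((hc.avg hν).hasSum hw).unique (h.congr_fun fun n => ?_)
  have : ∫ t in (0 : ℝ)..1, ((t ^ ν : ℝ) : ℂ) ^ n = (1 + (ν : ℂ) * n)⁻¹ := by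
    have e : ∀ t ∈ Set.uIcc (0 : ℝ) 1, ((t ^ ν : ℝ) : ℂ) ^ n = ((t ^ (ν * n) : ℝ) : ℂ) := by
      intro t ht
      rw [Set.uIcc_of_le zero_le_one] at ht
      rw [Real.rpow_mul_natCast ht.1]; push_cast; rfl
    rw [intervalIntegral.integral_congr e, intervalIntegral.integral_ofReal, integral_rpow]
    · have h0 : (0 : ℝ) < ν * n + 1 := by positivity
      rw [Real.one_rpow, Real.zero_rpow h0.ne', add_comm]
      push_cast; simp
    · left
      have : 0 ≤ ν * n := by positivity
      linarith
  rw [this]; ring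

end ConvOnDisc

/-! ### Minorants along the negative radius and their stability. -/

/-- `Re ∑ cₙ wⁿ` is bounded below by `Re ∑ dₙ (-|w|)ⁿ`. -/
structure MinorizedBy (c d : ℕ → ℂ) : Prop where
  left : ConvOnDisc c
  right : ConvOnDisc d
  le : ∀ w : ℂ, ‖w‖ < 1 → (pSum d (-(‖w‖ : ℂ))).re ≤ (pSum c w).re

/-- The function `r ↦ Re ∑ dₙ (-r)ⁿ` is nonnegative and decreasing on `[0, 1)`. -/
structure NonnegAntitone (d : ℕ → ℂ) : Prop where
  conv : ConvOnDisc d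
  nonneg : ∀ r : ℝ, 0 ≤ r → r < 1 → 0 ≤ (pSum d (-(r : ℂ))).re
  anti : ∀ r s : ℝ, 0 ≤ r → r ≤ s → s < 1 → (pSum d (-(s : ℂ))).re ≤ (pSum d (-(r : ℂ))).re

lemma MinorizedBy.avg {c d : ℕ → ℂ} (h : MinorizedBy c d) {ν : ℝ} (hν : 0 < ν) :
    MinorizedBy (fun n => (1 + (ν : ℂ) * n)⁻¹ * c n) (fun n => (1 + (ν : ℂ) * n)⁻¹ * d n) := by
  refine ⟨h.left.avg hν, h.right.avg hν, fun w hw => ?_⟩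
  have hw' : ‖-(‖w‖ : ℂ)‖ < 1 := by simpa using hw
  rw [h.left.re_pSum_avg hν hw, h.right.re_pSum_avg hν hw']
  refine intervalIntegral.integral_mono_on zero_le_one (h.right.intervalIntegrable_re_rpow hν hw')
    (h.left.intervalIntegrable_re_rpow hν hw) fun t ht => ?_
  have h0 := Real.rpow_nonneg ht.1 ν
  have := h.le ((t ^ ν : ℝ) * w)
    (norm_ofReal_mul_lt h0 (Real.rpow_le_one ht.1 ht.2 hν.le) hw)
  rwa [norm_mul, Complex.norm_real, Real.norm_of_nonneg h0, Complex.ofReal_mul, ← mul_neg] at this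

lemma MinorizedBy.combine {c d c' d' : ℕ → ℂ} (h : MinorizedBy c d) (h' : MinorizedBy c' d')
    {p p' : ℝ} (hp : 0 ≤ p) (hp' : 0 ≤ p') :
    MinorizedBy (fun n => (p : ℂ) * c n + (p' : ℂ) * c' n)
      (fun n => (p : ℂ) * d n + (p' : ℂ) * d' n) := by
  refine ⟨(h.left.const_mul _).add (h'.left.const_mul _),
    (h.right.const_mul _).add (h'.right.const_mul _), fun w hw => ?_⟩
  have hw' : ‖-(‖w‖ : ℂ)‖ < 1 := by simpa using hw
  rw [(h.left.const_mul _).pSum_add (h'.left.const_mul _) hw,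
    (h.right.const_mul _).pSum_add (h'.right.const_mul _) hw']
  simp only [ConvOnDisc.pSum_const_mul, Complex.add_re, Complex.re_ofReal_mul]
  have := h.le w hw
  have := h'.le w hw
  gcongr

lemma NonnegAntitone.avg {d : ℕ → ℂ} (h : NonnegAntitone d) {ν : ℝ} (hν : 0 < ν) :
    NonnegAntitone (fun n => (1 + (ν : ℂ) * n)⁻¹ * d n) := by
  have e : ∀ r : ℝ, 0 ≤ r → r < 1 → ‖-(r : ℂ)‖ < 1 := fun r h0 h1 => by
    simpa [abs_of_nonneg h0] using h1
  have e2 : ∀ t r : ℝ, ((t ^ ν : ℝ) : ℂ) * -(r : ℂ) = -((t ^ ν * r : ℝ) : ℂ) := fun t r => by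
    push_cast; ring
  have e3 : ∀ t ∈ Set.Icc (0 : ℝ) 1, ∀ r : ℝ, 0 ≤ r → r < 1 → 0 ≤ t ^ ν * r ∧ t ^ ν * r < 1 :=
    fun t ht r h0 h1 => ⟨mul_nonneg (Real.rpow_nonneg ht.1 ν) h0,
      (mul_le_of_le_one_left h0 (Real.rpow_le_one ht.1 ht.2 hν.le)).trans_lt h1⟩
  refine ⟨h.conv.avg hν, fun r h0 h1 => ?_, fun r s h0 hrs h1 => ?_⟩
  · rw [h.conv.re_pSum_avg hν (e r h0 h1)]
    refine intervalIntegral.integral_nonneg zero_le_one fun t ht => ?_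
    rw [e2]
    exact h.nonneg _ (e3 t ht r h0 h1).1 (e3 t ht r h0 h1).2
  · rw [h.conv.re_pSum_avg hν (e r h0 (hrs.trans_lt h1)),
      h.conv.re_pSum_avg hν (e s (h0.trans hrs) h1)]
    refine intervalIntegral.integral_mono_on zero_le_one
      (h.conv.intervalIntegrable_re_rpow hν (e s (h0.trans hrs) h1))
      (h.conv.intervalIntegrable_re_rpow hν (e r h0 (hrs.trans_lt h1))) fun t ht => ?_
    rw [e2, e2]
    exact h.anti _ _ (e3 t ht r h0 (hrs.trans_lt h1)).1
      (mul_le_mul_of_nonneg_left hrs (Real.rpow_nonneg ht.1 ν)) (e3 t ht s (h0.trans hrs) h1).2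

lemma NonnegAntitone.combine {d d' : ℕ → ℂ} (h : NonnegAntitone d) (h' : NonnegAntitone d')
    {p p' : ℝ} (hp : 0 ≤ p) (hp' : 0 ≤ p') :
    NonnegAntitone (fun n => (p : ℂ) * d n + (p' : ℂ) * d' n) := by
  have key : ∀ r : ℝ, 0 ≤ r → r < 1 →
      (pSum (fun n => (p : ℂ) * d n + (p' : ℂ) * d' n) (-(r : ℂ))).re =
      p * (pSum d (-(r : ℂ))).re + p' * (pSum d' (-(r : ℂ))).re := fun r h0 h1 => by
    rw [(h.conv.const_mul _).pSum_add (h'.conv.const_mul _) (by simpa [abs_of_nonneg h0] using h1)]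
    simp only [ConvOnDisc.pSum_const_mul, Complex.add_re, Complex.re_ofReal_mul]
  refine ⟨(h.conv.const_mul _).add (h'.conv.const_mul _), fun r h0 h1 => ?_,
    fun r s h0 hrs h1 => ?_⟩
  · rw [key r h0 h1]
    have := h.nonneg r h0 h1
    have := h'.nonneg r h0 h1
    positivity
  · rw [key r h0 (hrs.trans_lt h1), key s (h0.trans hrs) h1]
    have := h.anti r s h0 hrs h1
    have := h'.anti r s h0 hrs h1
    gcongr

/-- The multiplier `(n + 1) / ((1 + μ n) (1 + ν n))`. -/
noncomputable def coeffMult (μ ν : ℝ) (n : ℕ) : ℂ :=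
  (1 + (n : ℂ)) / ((1 + (μ : ℂ) * n) * (1 + (ν : ℂ) * n))

lemma one_add_mul_ne_zero {ν : ℝ} (hν : 0 < ν) (n : ℕ) : (1 + (ν : ℂ) * n) ≠ 0 := by
  have : (1 + (ν : ℂ) * n) = ((1 + ν * n : ℝ) : ℂ) := by push_cast; rfl
  rw [this, Complex.ofReal_ne_zero]
  positivity

/-- Partial fractions: `(1 + n) / (1 + μ n) = 1/μ + (1 - 1/μ) / (1 + μ n)`. Both weights are
nonnegative because `μ ≥ 1`, so the multiplier is a positive combination of averages. -/
lemma coeffMult_mul_eq {μ ν : ℝ} (hμ : 1 ≤ μ) (hν : 0 < ν) (c : ℕ → ℂ) :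
    (fun n : ℕ => Pascu.coeffMult μ ν n * c n) = fun n : ℕ => ((1 / μ : ℝ) : ℂ) * ((1 + (ν : ℂ) * n)⁻¹ * c n) +
      ((1 - 1 / μ : ℝ) : ℂ) * ((1 + (ν : ℂ) * n)⁻¹ * ((1 + (μ : ℂ) * n)⁻¹ * c n)) := by
  ext n
  have h1 := one_add_mul_ne_zero hν n
  have h2 := one_add_mul_ne_zero (zero_lt_one.trans_le hμ) n
  have h3 : (μ : ℂ) ≠ 0 := by
    rw [Complex.ofReal_ne_zero]; linarith
  rw [coeffMult]
  push_cast
  generalize 1 + (ν : ℂ) * n = A at *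
  generalize hB : 1 + (μ : ℂ) * n = B at *
  field_simp
  linear_combination c n * hB

lemma MinorizedBy.coeffMult {c d : ℕ → ℂ} (h : MinorizedBy c d) {μ ν : ℝ} (hμ : 1 ≤ μ) (hν : 0 < ν) :
    MinorizedBy (fun n => Pascu.coeffMult μ ν n * c n) (fun n => Pascu.coeffMult μ ν n * d n) := by
  have hμ0 : 0 < μ := zero_lt_one.trans_le hμ
  rw [coeffMult_mul_eq hμ hν, coeffMult_mul_eq hμ hν]
  refine (h.avg hν).combine ((h.avg hμ0).avg hν) (by positivity) ?_
  rw [sub_nonneg, div_le_one hμ0]; exact hμ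

lemma NonnegAntitone.coeffMult {d : ℕ → ℂ} (h : NonnegAntitone d) {μ ν : ℝ} (hμ : 1 ≤ μ) (hν : 0 < ν) :
    NonnegAntitone (fun n => Pascu.coeffMult μ ν n * d n) := by
  have hμ0 : 0 < μ := zero_lt_one.trans_le hμ
  rw [coeffMult_mul_eq hμ hν]
  refine (h.avg hν).combine ((h.avg hμ0).avg hν) (by positivity) ?_
  rw [sub_nonneg, div_le_one hμ0]; exact hμ

/-! ### The starlikeness kernel and its lower bound by `∫ lam q`. -/

/-- The coefficients `1 + n (1 + x) / 2` that test starlikeness. -/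
noncomputable def starCoeff (x : ℂ) (n : ℕ) : ℂ := 1 + (n : ℂ) * ((1 + x) / 2)

lemma hasSum_starCoeff (x : ℂ) {u : ℂ} (hu : ‖u‖ < 1) :
    HasSum (fun n => starCoeff x n * u ^ n) (1 / (1 - u) + (1 + x) / 2 * (u / (1 - u) ^ 2)) := by
  have h1 := hasSum_geometric_of_norm_lt_one hu
  have h2 := (hasSum_coe_mul_geometric_of_norm_lt_one hu).mul_left ((1 + x) / 2)
  rw [one_div]
  refine (h1.add h2).congr_fun fun n => ?_
  rw [starCoeff]; ring

lemma convOnDisc_starCoeff (x : ℂ) : ConvOnDisc (starCoeff x) :=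
  .of_summable fun _ hu => (hasSum_starCoeff x hu).summable

lemma pSum_starCoeff (x : ℂ) {u : ℂ} (hu : ‖u‖ < 1) :
    pSum (starCoeff x) u = 1 / (1 - u) + (1 + x) / 2 * (u / (1 - u) ^ 2) :=
  (hasSum_starCoeff x hu).tsum_eq

lemma re_pSum_starCoeff_one {r : ℝ} (h0 : 0 ≤ r) (h1 : r < 1) :
    (pSum (starCoeff 1) (-(r : ℂ))).re = 1 / (1 + r) ^ 2 := by
  rw [pSum_starCoeff 1 (by simpa [abs_of_nonneg h0] using h1)]
  have : (1 + (r : ℂ)) ≠ 0 := by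
    have : ((1 + r : ℝ) : ℂ) ≠ 0 := by rw [Complex.ofReal_ne_zero]; positivity
    simpa using this
  have e : 1 / (1 - -(r : ℂ)) + (1 + 1) / 2 * (-(r : ℂ) / (1 - -(r : ℂ)) ^ 2) =
      ((1 / (1 + r) ^ 2 : ℝ) : ℂ) := by
    push_cast
    rw [sub_neg_eq_add]
    field_simp
    ring
  rw [e, Complex.ofReal_re]

lemma nonnegAntitone_starCoeff_one : NonnegAntitone (starCoeff 1) := by
  refine ⟨convOnDisc_starCoeff 1, fun r h0 h1 => ?_, fun r s h0 hrs h1 => ?_⟩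
  · rw [re_pSum_starCoeff_one h0 h1]; positivity
  · rw [re_pSum_starCoeff_one h0 (hrs.trans_lt h1), re_pSum_starCoeff_one (h0.trans hrs) h1]
    gcongr

lemma Admissible.minorizedBy {lam : ℝ → ℝ} (hl : Admissible lam) {x : ℂ} (hx : ‖x‖ = 1) :
    MinorizedBy (fun n => moment lam n * starCoeff x n) (fun n => moment lam n * starCoeff 1 n) := by
  have hc := convOnDisc_starCoeff x
  have hd := convOnDisc_starCoeff 1
  refine ⟨hc.moment_mul hl.integrable, hd.moment_mul hl.integrable, fun w hw => ?_⟩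
  have hw' : ‖-(‖w‖ : ℂ)‖ < 1 := by simpa using hw
  rw [← hc.integral_weight_mul_re_pSum hl.integrable hw,
    ← hd.integral_weight_mul_re_pSum hl.integrable hw', ← sub_nonneg,
    ← intervalIntegral.integral_sub (hc.intervalIntegrable_weight hl.integrable hw)
      (hd.intervalIntegrable_weight hl.integrable hw')]
  have e : ∀ t ∈ Set.uIcc (0 : ℝ) 1, lam t * (pSum (starCoeff x) (t * w)).re -
      lam t * (pSum (starCoeff 1) (t * -(‖w‖ : ℂ))).re = lam t *
      ((1 / (1 - t * w) + (1 + x) / 2 * (t * w / (1 - t * w) ^ 2)).re - 1 / (1 + t * ‖w‖) ^ 2) := by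
    intro t ht
    rw [Set.uIcc_of_le zero_le_one] at ht
    have h1 : t * ‖w‖ < 1 := (mul_le_of_le_one_left (norm_nonneg _) ht.2).trans_lt hw
    rw [pSum_starCoeff x (norm_ofReal_mul_lt ht.1 ht.2 hw), mul_neg, ← Complex.ofReal_mul,
      re_pSum_starCoeff_one (mul_nonneg ht.1 (norm_nonneg _)) h1]
    ring
  rw [intervalIntegral.integral_congr e]
  refine integral_weight_kernel_nonneg hl hw hx ?_
  refine ((hc.intervalIntegrable_weight hl.integrable hw).sub
    (hd.intervalIntegrable_weight hl.integrable hw')).congr fun t ht => ?_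
  exact e t (Set.uIoc_subset_uIcc ht)

lemma q_eq {μ ν : ℝ} (t : ℝ) :
    q μ ν t = (pSum (fun n => Pascu.coeffMult μ ν n * starCoeff 1 n) (-(t : ℂ))).re := by
  have : pSum (fun n => Pascu.coeffMult μ ν n * starCoeff 1 n) (-(t : ℂ)) = (q μ ν t : ℂ) := by
    rw [q, Complex.ofReal_tsum, pSum]
    congr 1 with n
    rw [coeffMult, starCoeff, neg_pow]
    push_cast
    ring
  rw [this, Complex.ofReal_re]

/-- The lower bound of the transformed starlikeness kernel by `∫ lam q`. -/
lemma Admissible.integral_mul_q_le {lam : ℝ → ℝ} (hl : Admissible lam) {x : ℂ} (hx : ‖x‖ = 1)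
    {μ ν : ℝ} (hμ : 1 ≤ μ) (hν : 0 < ν) {w : ℂ} (hw : ‖w‖ < 1) :
    ∫ t in (0 : ℝ)..1, lam t * q μ ν t ≤
      (pSum (fun n => Pascu.coeffMult μ ν n * (moment lam n * starCoeff x n)) w).re := by
  have hA := nonnegAntitone_starCoeff_one.coeffMult hμ hν
  have hw' : ‖-(‖w‖ : ℂ)‖ < 1 := by simpa using hw
  refine le_trans ?_ (((hl.minorizedBy hx).coeffMult hμ hν).le w hw)
  have e : (fun n => Pascu.coeffMult μ ν n * (moment lam n * starCoeff 1 n)) =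
      fun n => moment lam n * (Pascu.coeffMult μ ν n * starCoeff 1 n) := by ext n; ring
  rw [e, ← hA.conv.integral_weight_mul_re_pSum hl.integrable hw']
  -- Monotonicity supplies the measurability of `q`, and with nonnegativity its bound by `q μ ν 0`.
  have hanti : AntitoneOn (q μ ν) (Set.Ioo 0 1) := fun r hr s hs hrs => by
    rw [q_eq, q_eq]; exact hA.anti r s hr.1.le hrs hs.2
  have hq0 : ∀ t ∈ Set.Ioo (0 : ℝ) 1, ‖q μ ν t‖ ≤ q μ ν 0 := fun t ht => by
    rw [q_eq, q_eq, Real.norm_of_nonneg (hA.nonneg t ht.1.le ht.2)]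
    exact_mod_cast hA.anti 0 t le_rfl ht.1.le ht.2
  have hint : IntervalIntegrable (fun t => lam t * q μ ν t) volume 0 1 := by
    have h1 := hl.integrable
    rw [intervalIntegrable_iff_integrableOn_Ioo_of_le zero_le_one] at h1 ⊢
    refine Integrable.mul_bdd (c := q μ ν 0) h1
      (aemeasurable_restrict_of_antitoneOn measurableSet_Ioo hanti).aestronglyMeasurable ?_
    exact (ae_restrict_iff' measurableSet_Ioo).2 (.of_forall hq0)
  refine intervalIntegral.integral_mono_on_of_le_Ioo zero_le_one hint
    (hA.conv.intervalIntegrable_weight hl.integrable hw') fun t ht => ?_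
  refine mul_le_mul_of_nonneg_left ?_ (hl.nonneg t ht)
  rw [q_eq, mul_neg, ← Complex.ofReal_mul]
  -- Since `t|w| ≤ t`, monotonicity replaces the minorant at `t|w|` by its value `q` at `t`.
  exact hA.anti _ _ (mul_nonneg ht.1.le (norm_nonneg _))
    (mul_le_of_le_one_right ht.1.le hw.le) ht.2

/-! ### Admissibility of the weights. -/

/-- Bernoulli's inequality for the exponent `1 - k` in `[0, 1)`, multiplied by `s ^ k`. -/
lemma sub_mul_rpow_le {k s : ℝ} (hk : 0 < k) (hk1 : k ≤ 1) (hs : 0 < s) :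
    s - s * s ^ k ≤ k * s ^ k * (1 - s) := by
  have h := rpow_one_add_le_one_add_mul_self (s := s - 1) (by linarith) (p := 1 - k)
    (by linarith) (by linarith)
  rw [add_sub_cancel] at h
  have h2 := mul_le_mul_of_nonneg_left h (Real.rpow_pos_of_pos hs k).le
  rw [← Real.rpow_add hs, add_sub_cancel, Real.rpow_one] at h2
  linarith

/-- Compares `s ^ k` with its `[1/1]` Padé approximant at `s = 1`. The difference `Φ` vanishes at
`1` and is decreasing by Bernoulli's inequality at `1 / t`. -/
lemma pade_le_rpow {k s : ℝ} (hk : 1 ≤ k) (hs : 0 < s) (hs1 : s < 1) :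
    (k + 1) * s - (k - 1) ≤ s ^ k * ((k + 1) - (k - 1) * s) := by
  set Φ : ℝ → ℝ := fun s => s ^ k * ((k + 1) - (k - 1) * s) - ((k + 1) * s - (k - 1)) with hΦ
  have hd : ∀ t : ℝ, 0 < t → HasDerivAt Φ (k * t ^ (k - 1) * ((k + 1) - (k - 1) * t) +
      t ^ k * (-(k - 1)) - (k + 1)) t := by
    intro t ht
    have h1 := Real.hasDerivAt_rpow_const (p := k) (Or.inl ht.ne')
    have h2 : HasDerivAt (fun s : ℝ => (k + 1) - (k - 1) * s) (-(k - 1)) t := by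
      simpa using ((hasDerivAt_id t).const_mul (k - 1)).const_sub (k + 1)
    have h3 : HasDerivAt (fun s : ℝ => (k + 1) * s - (k - 1)) (k + 1) t := by
      simpa using ((hasDerivAt_id t).const_mul (k + 1)).sub_const (k - 1)
    exact (h1.mul h2).sub h3
  have hanti : AntitoneOn Φ (Set.Icc s 1) := by
    refine antitoneOn_of_deriv_nonpos (convex_Icc s 1)
      (fun t ht => (hd t (hs.trans_le ht.1)).continuousAt.continuousWithinAt)
      (fun t ht => ?_) fun t ht => ?_
    · rw [interior_Icc] at ht
      exact (hd t (hs.trans ht.1)).differentiableAt.differentiableWithinAt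
    · rw [interior_Icc] at ht
      have ht0 := hs.trans ht.1
      rw [(hd t ht0).deriv]
      have hb := one_add_mul_self_le_rpow_one_add (s := t⁻¹ - 1)
        (by have := inv_pos.2 ht0; linarith) hk
      rw [add_sub_cancel, Real.inv_rpow ht0.le] at hb
      have hpos := Real.rpow_pos_of_pos ht0 k
      have h4 := mul_le_mul_of_nonneg_left hb hpos.le
      rw [mul_inv_cancel₀ hpos.ne'] at h4
      have h5 : t ^ (k - 1) = t ^ k * t⁻¹ := by
        rw [Real.rpow_sub_one ht0.ne', div_eq_mul_inv]
      have h6 : k * t ^ (k - 1) * ((k + 1) - (k - 1) * t) + t ^ k * (-(k - 1)) - (k + 1) =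
          (k + 1) * (t ^ k * (1 + k * (t⁻¹ - 1)) - 1) := by
        rw [h5]; field_simp; ring
      rw [h6]
      exact mul_nonpos_of_nonneg_of_nonpos (by linarith) (by linarith)
  have := hanti (Set.left_mem_Icc.2 hs1.le) (Set.right_mem_Icc.2 hs1.le) hs1.le
  simp only [hΦ, Real.one_rpow] at this
  linarith

/-- Put `s = t²` and `k = (b - a) / 2`, and divide by `t ^ a`. For `k ≤ 1` the sign of `a` and
Bernoulli suffice. For `k ≥ 1` the hypothesis `a + b ≤ 2` says `a ≤ 1 - k`, and the extremal case `a
= 1 - k` is the Padé bound. -/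
lemma rpow_sub_rpow_deriv_le {a b t : ℝ} (hab : a < b) (ha0 : a ≤ 0) (hs : a + b ≤ 2)
    (ht0 : 0 < t) (ht1 : t < 1) :
    (a * t ^ a - b * t ^ b) * (1 - t ^ 2) + 2 * t ^ 2 * (t ^ a - t ^ b) ≤ 0 := by
  have hs0 : 0 < t ^ 2 := by positivity
  have hs1 : t ^ 2 < 1 := by nlinarith
  have hy : t ^ b = t ^ a * (t ^ 2) ^ ((b - a) / 2) := by
    rw [← Real.rpow_natCast t 2, ← Real.rpow_mul ht0.le, ← Real.rpow_add ht0]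
    congr 1; push_cast; ring
  have hk : 0 < (b - a) / 2 := by linarith
  have hA := Real.rpow_pos_of_pos ht0 a
  rw [hy]
  obtain ⟨k, hkdef⟩ : ∃ k, k = (b - a) / 2 := ⟨_, rfl⟩
  have hb : b = a + 2 * k := by linarith
  rw [← hkdef] at hk ⊢
  generalize t ^ 2 = s at *
  have hY := Real.rpow_pos_of_pos hs0 k
  have hY1 : s ^ k ≤ 1 := Real.rpow_le_one hs0.le hs1.le hk.le
  have key : (a - b * s ^ k) * (1 - s) + 2 * s * (1 - s ^ k) ≤ 0 := by
    subst hb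
    have h1 : 0 ≤ (1 - s ^ k) * (1 - s) := mul_nonneg (by linarith) (by linarith)
    rcases le_total k 1 with hk1 | hk1
    · have h2 := sub_mul_rpow_le hk hk1 hs0
      nlinarith [mul_nonneg (neg_nonneg.2 ha0) h1]
    · have h2 := pade_le_rpow hk1 hs0 hs1
      have h3 : k - 1 ≤ -a := by linarith
      nlinarith [mul_le_mul_of_nonneg_right h3 h1]
  have := mul_nonpos_of_nonneg_of_nonpos hA.le key
  linarith

lemma admissible_of_eq_rpow_sub {lam : ℝ → ℝ} {a b : ℝ} (ha : -1 < a) (hab : a < b) (ha0 : a ≤ 0)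
    (hs : a + b ≤ 2)
    (h : ∀ t, 0 < t → lam t = (a + 1) * (b + 1) / (b - a) * (t ^ a - t ^ b)) :
    Admissible lam := by
  have hb : -1 < b := ha.trans hab
  set C := (a + 1) * (b + 1) / (b - a) with hC
  have hC0 : 0 < C := div_pos (mul_pos (by linarith) (by linarith)) (by linarith)
  have ia : IntervalIntegrable (fun t : ℝ => t ^ a) volume 0 1 :=
    intervalIntegral.intervalIntegrable_rpow' ha
  have ib : IntervalIntegrable (fun t : ℝ => t ^ b) volume 0 1 :=
    intervalIntegral.intervalIntegrable_rpow' hb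
  have he : ∀ t ∈ Set.uIoc (0 : ℝ) 1, C * (t ^ a - t ^ b) = lam t := fun t ht => by
    rw [Set.uIoc_of_le zero_le_one] at ht; exact (h t ht.1).symm
  refine ⟨((ia.sub ib).const_mul C).congr he, fun t ht => ?_, ?_, ?_, ?_, fun t ht => ?_⟩
  · rw [h t ht.1]
    have := Real.rpow_le_rpow_of_exponent_ge ht.1 ht.2.le hab.le
    exact mul_nonneg hC0.le (by linarith)
  · rw [← intervalIntegral.integral_congr_ae (.of_forall he), intervalIntegral.integral_const_mul,
      intervalIntegral.integral_sub ia ib, integral_rpow (Or.inl ha), integral_rpow (Or.inl hb)]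
    have h1 : a + 1 ≠ 0 := by linarith
    have h2 : b + 1 ≠ 0 := by linarith
    have h3 : b - a ≠ 0 := by linarith
    simp only [Real.one_rpow, Real.zero_rpow h1, Real.zero_rpow h2, hC]
    field_simp
    ring
  · have hc : ContinuousOn (fun t : ℝ => C * (t ^ (a + 2) - t ^ (b + 2))) (Set.Icc 0 1) := by
      have h1 := Real.continuous_rpow_const (q := a + 2) (by linarith)
      have h2 := Real.continuous_rpow_const (q := b + 2) (by linarith)
      exact (continuous_const.mul (h1.sub h2)).continuousOn
    -- The formula for `lam` is known only for `t > 0`; at `0` the factor `t ^ 2` makes the value of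
    -- `lam 0` irrelevant.
    refine hc.congr fun t ht => ?_
    rcases ht.1.eq_or_lt with rfl | ht0
    · have h1 : a + 2 ≠ 0 := by linarith
      have h2 : b + 2 ≠ 0 := by linarith
      simp [Real.zero_rpow h1, Real.zero_rpow h2]
    · simp only [h t ht0, Real.rpow_add ht0, Real.rpow_ofNat]
      ring
  · rw [h 1 one_pos]; simp
  · have hev : lam =ᶠ[nhds t] fun t => C * (t ^ a - t ^ b) := by
      filter_upwards [lt_mem_nhds ht.1] with u hu using h u hu
    refine ⟨_, (((Real.hasDerivAt_rpow_const (Or.inl ht.1.ne')).sub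
      (Real.hasDerivAt_rpow_const (Or.inl ht.1.ne'))).const_mul C).congr_of_eventuallyEq hev, ?_⟩
    have key := rpow_sub_rpow_deriv_le hab ha0 hs ht.1 ht.2
    rw [h t ht.1, Real.rpow_sub_one ht.1.ne', Real.rpow_sub_one ht.1.ne']
    have ht0 := ht.1.ne'
    have : C * (a * (t ^ a / t) - b * (t ^ b / t)) * (1 - t ^ 2) +
        2 * t * (C * (t ^ a - t ^ b)) = C / t *
        ((a * t ^ a - b * t ^ b) * (1 - t ^ 2) + 2 * t ^ 2 * (t ^ a - t ^ b)) := by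
      field_simp
    rw [this]
    exact mul_nonpos_of_nonneg_of_nonpos (div_nonneg hC0.le ht.1.le) key

lemma continuous_rpow_mul_log {p : ℝ} (hp : 0 < p) :
    Continuous fun t : ℝ => t ^ p * Real.log (t ^ p) :=
  Real.continuous_mul_log.comp (Real.continuous_rpow_const hp.le)

lemma admissible_of_eq_rpow_mul_log {lam : ℝ → ℝ} {a : ℝ} (ha : -1 < a) (ha0 : a ≤ 0)
    (h : ∀ t, 0 < t → lam t = (a + 1) ^ 2 * t ^ a * Real.log (1 / t)) :
    Admissible lam := by
  have hp : 0 < a + 1 := by linarith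
  have h' : ∀ t, 0 < t → lam t = (a + 1) ^ 2 * (t ^ a * -Real.log t) := fun t ht => by
    rw [h t ht, one_div, Real.log_inv, mul_assoc]
  have hnn : ∀ t ∈ Set.Ioo (0 : ℝ) 1, 0 ≤ lam t := fun t ht => by
    rw [h' t ht.1]
    have := Real.log_nonpos ht.1.le ht.2.le
    have := Real.rpow_nonneg ht.1.le a
    exact mul_nonneg (sq_nonneg _) (mul_nonneg this (by linarith))
  -- A primitive of `lam`, written through `u * log u` with `u = t ^ (a + 1)` so that continuity at
  -- `0` is immediate.
  set G : ℝ → ℝ := fun t => -(t ^ (a + 1) * Real.log (t ^ (a + 1))) + t ^ (a + 1) with hG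
  have hGc : ContinuousOn G (Set.Icc 0 1) :=
    ((continuous_rpow_mul_log hp).neg.add (Real.continuous_rpow_const hp.le)).continuousOn
  have hGd : ∀ t ∈ Set.Ioo (0 : ℝ) 1, HasDerivAt G (lam t) t := by
    intro t ht
    have h1 := Real.hasDerivAt_rpow_const (p := a + 1) (Or.inl ht.1.ne')
    have hpos := Real.rpow_pos_of_pos ht.1 (a + 1)
    have h2 := ((h1.mul (h1.log hpos.ne')).neg.add h1)
    refine h2.congr_deriv ?_
    rw [h' t ht.1, Real.log_rpow ht.1, add_sub_cancel_right]
    field_simp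
    ring
  have hint : IntervalIntegrable lam volume 0 1 :=
    (intervalIntegrable_iff_integrableOn_Ioc_of_le zero_le_one).2
      (intervalIntegral.integrableOn_deriv_of_nonneg hGc hGd hnn)
  refine ⟨hint, hnn, ?_, ?_, ?_, fun t ht => ?_⟩
  · rw [intervalIntegral.integral_eq_sub_of_hasDerivAt_of_le zero_le_one hGc hGd hint]
    simp [hG, Real.zero_rpow hp.ne']
  · have hc : ContinuousOn (fun t : ℝ => -(a + 1) * (t * (t ^ (a + 1) * Real.log (t ^ (a + 1)))))
        (Set.Icc 0 1) :=
      (continuous_const.mul (continuous_id.mul (continuous_rpow_mul_log hp))).continuousOn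
    refine hc.congr fun t ht => ?_
    rcases ht.1.eq_or_lt with rfl | ht0
    · simp
    · simp only [h' t ht0]
      rw [Real.log_rpow ht0, Real.rpow_add_one ht0.ne']
      ring
  · rw [h 1 one_pos]; simp
  · have hev : lam =ᶠ[nhds t] fun t => (a + 1) ^ 2 * (t ^ a * -Real.log t) := by
      filter_upwards [lt_mem_nhds ht.1] with u hu using h' u hu
    refine ⟨_, (((Real.hasDerivAt_rpow_const (Or.inl ht.1.ne')).mul
      (Real.hasDerivAt_log ht.1.ne').neg).const_mul _).congr_of_eventuallyEq hev, ?_⟩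
    have ht0 := ht.1
    have hA := Real.rpow_pos_of_pos ht0 a
    have hs : 0 < t ^ 2 := by positivity
    -- The bound `log u ≤ u - 1` at `u = t⁻²` yields `-2 t² log t ≤ 1 - t²`; the remaining term is
    -- nonpositive because `a ≤ 0`.
    have hlog := Real.log_le_sub_one_of_pos (inv_pos.2 hs)
    rw [Real.log_inv, Real.log_pow] at hlog
    push_cast at hlog
    have h3 : 2 * t ^ 2 * -Real.log t ≤ 1 - t ^ 2 := by
      have := mul_le_mul_of_nonneg_left hlog hs.le
      rw [mul_sub, mul_inv_cancel₀ hs.ne'] at this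
      linarith
    have h4 := Real.log_nonpos ht0.le ht.2.le
    have h5 : 0 ≤ 1 - t ^ 2 := by nlinarith [ht.2]
    rw [h' t ht0, Real.rpow_sub_one ht0.ne']
    have : (a + 1) ^ 2 * (a * (t ^ a / t) * -Real.log t + t ^ a * -t⁻¹) * (1 - t ^ 2) +
        2 * t * ((a + 1) ^ 2 * (t ^ a * -Real.log t)) = (a + 1) ^ 2 * t ^ a / t *
        ((a * -Real.log t) * (1 - t ^ 2) + (2 * t ^ 2 * -Real.log t - (1 - t ^ 2))) := by
      field_simp
      ring
    rw [Pi.neg_apply, this]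
    refine mul_nonpos_of_nonneg_of_nonpos (by positivity) ?_
    have := mul_nonpos_of_nonpos_of_nonneg
      (mul_nonpos_of_nonpos_of_nonneg ha0 (neg_nonneg.2 h4)) h5
    linarith

lemma weight_eq {a b t : ℝ} (hab : a ≠ b) (ht : 0 < t) :
    weight a b t = (a + 1) * (b + 1) / (b - a) * (t ^ a - t ^ b) := by
  rw [weight, if_neg hab.symm, mul_sub, mul_one, ← Real.rpow_add ht, add_sub_cancel]
  ring

lemma admissible_weight_of_lt {a b : ℝ} (ha : -1 < a) (hab : a < b) (ha0 : a ≤ 0)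
    (hs : a + b ≤ 2) : Admissible (weight a b) :=
  admissible_of_eq_rpow_sub ha hab ha0 hs fun _ ht => weight_eq hab.ne ht

lemma admissible_weight_of_gt {a b : ℝ} (hb : -1 < b) (hab : b < a) (hb0 : b ≤ 0)
    (hs : a + b ≤ 2) : Admissible (weight a b) :=
  admissible_of_eq_rpow_sub hb hab hb0 (by linarith) fun t ht => by
    rw [weight_eq hab.ne' ht]
    have h1 : b - a ≠ 0 := by linarith
    have h2 : a - b ≠ 0 := by linarith
    field_simp
    ring

lemma admissible_weight_self {a : ℝ} (ha : -1 < a) (ha0 : a ≤ 0) : Admissible (weight a a) :=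
  admissible_of_eq_rpow_mul_log ha ha0 fun t _ => by rw [weight, if_pos rfl]

/-! ### The two function classes in terms of coefficients. -/

lemma pSum_zero (c : ℕ → ℂ) : pSum c 0 = c 0 := by
  rw [pSum, tsum_eq_single 0 fun n hn => by simp [hn]]
  simp

lemma deriv_eq_of_eqOn_disc {F G : ℂ → ℂ} (h : ∀ w : ℂ, ‖w‖ < 1 → F w = G w) {z : ℂ}
    (hz : ‖z‖ < 1) : deriv F z = deriv G z := by
  refine Filter.EventuallyEq.deriv_eq ?_
  filter_upwards [isOpen_ball.mem_nhds (mem_ball_zero_iff.2 hz)] with w hw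
  exact h w (mem_ball_zero_iff.1 hw)

lemma exists_coeff_of_mem_classA {f : ℂ → ℂ} (hf : f ∈ classA) :
    ∃ c : ℕ → ℂ, ConvOnDisc c ∧ c 0 = 1 ∧
      ∀ z : ℂ, ‖z‖ < 1 → dslope f 0 z = pSum c z ∧ f z = z * pSum c z := by
  obtain ⟨hd, h0, h1⟩ := hf
  have hg : DifferentiableOn ℂ (dslope f 0) (ball 0 1) :=
    (Complex.differentiableOn_dslope (isOpen_ball.mem_nhds (mem_ball_self one_pos))).2 hd
  have hs : ∀ z : ℂ, ‖z‖ < 1 →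
      HasSum (fun n : ℕ => ((n.factorial : ℂ)⁻¹ * iteratedDeriv n (dslope f 0) 0) * z ^ n)
        (dslope f 0 z) := by
    intro z hz
    refine (Complex.hasSum_taylorSeries_on_ball hg (mem_ball_zero_iff.2 hz)).congr_fun fun n => ?_
    simp only [sub_zero, smul_eq_mul]
    ring
  refine ⟨_, .of_summable fun z hz => (hs z hz).summable, ?_, fun z hz => ?_⟩
  · simp [dslope_same, h1]
  · have e := (hs z hz).tsum_eq
    refine ⟨e.symm, ?_⟩
    have := sub_smul_dslope f 0 z
    rw [h0, sub_zero, sub_zero, smul_eq_mul] at this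
    rw [← this, pSum, e]

/-- The `n`-th multiplier is `1 + (α - γ) n + γ n²`, which factors by the relations defining `μ` and
`ν`. -/
lemma classW_expr_eq_pSum {f : ℂ → ℂ} {c : ℕ → ℂ} (hc : ConvOnDisc c)
    (h : ∀ z : ℂ, ‖z‖ < 1 → dslope f 0 z = pSum c z ∧ f z = z * pSum c z) {α γ μ ν : ℝ}
    (hsum : μ + ν = α - γ) (hprod : μ * ν = γ) {z : ℂ} (hz : ‖z‖ < 1) :
    (1 - (α : ℂ) + 2 * (γ : ℂ)) * dslope f 0 z + ((α : ℂ) - 2 * (γ : ℂ)) * deriv f z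
        + (γ : ℂ) * z * deriv (deriv f) z =
      pSum (fun n => (1 + (μ : ℂ) * n) * (1 + (ν : ℂ) * n) * c n) z := by
  have hc1 : ConvOnDisc fun n => (1 + (n : ℂ)) * c n := by
    simpa using hc.linear_mul 1 1
  have hf' : ∀ w : ℂ, ‖w‖ < 1 → deriv f w = pSum (fun n => (1 + (n : ℂ)) * c n) w := fun w hw => by
    rw [deriv_eq_of_eqOn_disc (fun u hu => (h u hu).2) hw, hc.deriv_id_mul hw]
  have hα : (α : ℂ) = μ + ν + μ * ν := by
    rw [← hprod] at hsum
    have : α = μ + ν + μ * ν := by linarith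
    rw [this]; push_cast; ring
  rw [(h z hz).1, hf' z hz, mul_assoc (γ : ℂ), deriv_eq_of_eqOn_disc hf' hz, hc1.mul_deriv hz,
    ← ConvOnDisc.pSum_const_mul, ← ConvOnDisc.pSum_const_mul, ← ConvOnDisc.pSum_const_mul,
    ← (hc.const_mul _).pSum_add (hc1.const_mul _) hz,
    ← ((hc.const_mul _).add (hc1.const_mul _)).pSum_add (hc1.natCast_mul.const_mul _) hz]
  congr 1
  ext n
  rw [hα, ← hprod]
  push_cast
  ring

/-- With `u = e A` and `v = e B`, the worst `x` gives `|v - u| < Re (u + v) ≤ |u + v|`, hence `Re (v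
* conj u) > 0`. In particular `A ≠ 0` comes for free. -/
lemma re_div_pos_of_forall_unit {e A B : ℂ} (he : e ≠ 0)
    (h : ∀ x : ℂ, ‖x‖ = 1 → 0 < (e * (A + (1 + x) / 2 * (B - A))).re) : 0 < (B / A).re := by
  have hBA : B / A = (e * B) / (e * A) := (mul_div_mul_left B A he).symm
  have h' : ∀ x : ℂ, ‖x‖ = 1 → 0 < ((e * A + e * B) + x * (e * B - e * A)).re := fun x hx => by
    have h1 := h x hx
    have h2 : (e * A + e * B) + x * (e * B - e * A) =
        ((2 : ℝ) : ℂ) * (e * (A + (1 + x) / 2 * (B - A))) := by push_cast; ring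
    rw [h2, Complex.re_ofReal_mul]
    linarith
  rw [hBA]
  generalize e * A = u at *
  generalize e * B = v at *
  have key : ‖v - u‖ < (u + v).re := by
    by_cases hne : v - u = 0
    · have := h' 1 (by simp)
      rw [hne] at this ⊢
      simpa using this
    · have hn : ‖v - u‖ ≠ 0 := norm_ne_zero_iff.2 hne
      -- This `x` rotates `v - u` onto the negative real axis.
      have h1 := h' (-((starRingEnd ℂ) (v - u) / ‖v - u‖)) (by
        rw [norm_neg, norm_div, RCLike.norm_conj, Complex.norm_real, norm_norm, div_self hn])
      have h2 : -((starRingEnd ℂ) (v - u) / ‖v - u‖) * (v - u) = ((-‖v - u‖ : ℝ) : ℂ) := by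
        rw [neg_mul, div_mul_eq_mul_div, mul_comm, Complex.mul_conj, Complex.normSq_eq_norm_sq]
        push_cast
        have : (‖v - u‖ : ℂ) ≠ 0 := by exact_mod_cast hn
        field_simp
      rw [h2, Complex.add_re, Complex.ofReal_re] at h1
      linarith
  have h3 : ‖v - u‖ ^ 2 < (u + v).re ^ 2 := by
    have := norm_nonneg (v - u)
    nlinarith
  rw [Complex.sq_norm, Complex.normSq_apply] at h3
  simp only [Complex.sub_re, Complex.sub_im, Complex.add_re] at h3
  have h4 : 0 < v.re * u.re + v.im * u.im := by nlinarith [sq_nonneg (u.im + v.im)]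
  have hu : 0 < Complex.normSq u := by
    rw [Complex.normSq_pos]
    rintro rfl
    simp at h4
  rw [Complex.div_re, ← add_div]
  exact div_pos h4 hu

/-- The positivity statement behind the main theorem, for one unimodular test parameter. -/
lemma re_exp_mul_pSum_pos {lam : ℝ → ℝ} (hl : Admissible lam) {x : ℂ} (hx : ‖x‖ = 1)
    {ξ β μ ν : ℝ} (hξ0 : 0 ≤ ξ) (hξ1 : ξ ≤ 1) (hμ : 1 ≤ μ) (hν : 0 < ν) (hβ : β < 1)
    (hβeq : (β - 1 / 2) / (1 - β) = -∫ t in (0 : ℝ)..1, lam t * q μ ν t)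
    {c : ℕ → ℂ} (hc : ConvOnDisc c) (hc0 : c 0 = 1) {e : ℂ}
    (h : ∀ z : ℂ, ‖z‖ < 1 →
      0 < (e * (pSum (fun n => (1 + (μ : ℂ) * n) * (1 + (ν : ℂ) * n) * c n) z - β)).re)
    {z : ℂ} (hz : ‖z‖ < 1) :
    0 < (e * pSum (fun n => starCoeff x n * ((1 + (ξ : ℂ) * n) * (moment lam n * c n))) z).re := by
  have hμ0 : 0 < μ := zero_lt_one.trans_le hμ
  have hm0 : moment lam 0 = 1 := by simpa [moment] using hl.integral_eq
  let δ : ℕ → ℂ := fun n => if n = 0 then 1 else 0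
  have hδz : ∀ u : ℂ, HasSum (fun n => δ n * u ^ n) 1 := fun u =>
    (hasSum_ite_eq 0 (1 : ℂ)).congr_fun fun n => by by_cases hn : n = 0 <;> simp [δ, hn]
  have hδ : ConvOnDisc δ := .of_summable fun u _ => (hδz u).summable
  have hδs : ∀ u, pSum δ u = 1 := fun u => (hδz u).tsum_eq
  let K : ℕ → ℂ := fun n => coeffMult μ ν n * (moment lam n * starCoeff x n)
  have hK : ConvOnDisc K := ((hl.minorizedBy hx).coeffMult hμ hν).left
  have hK1 := hK.avg one_pos
  set Q := ∫ t in (0 : ℝ)..1, lam t * q μ ν t with hQ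
  have hKle : ∀ w : ℂ, ‖w‖ < 1 → Q ≤ (pSum K w).re := fun w hw => hl.integral_mul_q_le hx hμ hν hw
  have hK1le : ∀ w : ℂ, ‖w‖ < 1 →
      Q ≤ (pSum (fun n => (1 + ((1 : ℝ) : ℂ) * n)⁻¹ * K n) w).re := fun w hw => by
    rw [hK.re_pSum_avg one_pos hw]
    have : Q = ∫ _t in (0 : ℝ)..1, Q := by simp
    rw [this]
    refine intervalIntegral.integral_mono_on zero_le_one intervalIntegrable_const
      (hK.intervalIntegrable_re_rpow one_pos hw) fun t ht => hKle _ ?_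
    exact norm_ofReal_mul_lt (Real.rpow_nonneg ht.1 _)
      (Real.rpow_le_one ht.1 ht.2 zero_le_one) hw
  -- The identity `(1 - ξ) / (1 + n) + ξ = (1 + ξ n) / (1 + n)` produces the factor `1 + ξ n` and
  -- cancels the `1 + n` of `coeffMult`. As a convex combination of `K` and an average of `K`, `κ`
  -- keeps the lower bound `Q`.
  let κ : ℕ → ℂ := fun n =>
    ((1 - ξ : ℝ) : ℂ) * ((1 + ((1 : ℝ) : ℂ) * n)⁻¹ * K n) + (ξ : ℂ) * K n
  have hκ : ConvOnDisc κ := (hK1.const_mul _).add (hK.const_mul _)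
  have hκle : ∀ w : ℂ, ‖w‖ < 1 → Q ≤ (pSum κ w).re := fun w hw => by
    rw [(hK1.const_mul _).pSum_add (hK.const_mul _) hw]
    simp only [ConvOnDisc.pSum_const_mul, Complex.add_re, Complex.re_ofReal_mul]
    have h1 := mul_le_mul_of_nonneg_left (hK1le w hw) (sub_nonneg.2 hξ1)
    have h2 := mul_le_mul_of_nonneg_left (hKle w hw) hξ0
    linarith
  -- The equation for `β` reads `(1 - β) Q + β = 1/2`, so the bound `Re κ ≥ Q` becomes `Re s ≥ 1/2`.
  let s : ℕ → ℂ := fun n => ((1 - β : ℝ) : ℂ) * κ n + (β : ℂ) * δ n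
  have hs : ConvOnDisc s := (hκ.const_mul _).add (hδ.const_mul _)
  have hκ0 : κ 0 = 1 := by
    simp [κ, K, coeffMult, starCoeff, hm0]
  have hs0 : s 0 = 1 := by
    simp [s, hκ0, δ]
  have hsle : ∀ w : ℂ, ‖w‖ < 1 → 1 / 2 ≤ (pSum s w).re := fun w hw => by
    rw [(hκ.const_mul _).pSum_add (hδ.const_mul _) hw]
    simp only [ConvOnDisc.pSum_const_mul, Complex.add_re, Complex.re_ofReal_mul, hδs,
      Complex.one_re]
    have h1 := mul_le_mul_of_nonneg_left (hκle w hw) (sub_pos.2 hβ).le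
    have h2 : β - 1 / 2 = -Q * (1 - β) := (div_eq_iff (sub_pos.2 hβ).ne').1 hβeq
    linarith
  let H : ℕ → ℂ := fun n => (1 + (μ : ℂ) * n) * (1 + (ν : ℂ) * n) * c n
  have hH : ConvOnDisc H := by
    have := (hc.linear_mul 1 (ν : ℂ)).linear_mul 1 (μ : ℂ)
    simpa only [H, mul_assoc] using this
  let P : ℕ → ℂ := fun n => e * (H n + -(β : ℂ) * δ n)
  have hP : ConvOnDisc P := (hH.add (hδ.const_mul _)).const_mul e
  have hPz : ∀ u : ℂ, ‖u‖ < 1 → pSum P u = e * (pSum H u - β) := fun u hu => by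
    rw [ConvOnDisc.pSum_const_mul, hH.pSum_add (hδ.const_mul _) hu, ConvOnDisc.pSum_const_mul, hδs]
    ring
  have key := re_pSum_mul_pos hP hs hs0 (fun u hu => by rw [hPz u hu]; exact h u hu) hsle hz
  -- For `n = 0` the factor `1 - β` comes from `P` (and `s 0 = 1`); for `n ≥ 1` it comes from `s`.
  have e1 : (fun n => P n * s n) = fun n => ((1 - β : ℝ) : ℂ) *
      (e * (starCoeff x n * ((1 + (ξ : ℂ) * n) * (moment lam n * c n)))) := by
    ext n
    rcases Nat.eq_zero_or_pos n with rfl | hn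
    · rw [hs0]
      simp [P, H, δ, hc0, starCoeff, hm0]
      ring
    · have hμn := one_add_mul_ne_zero hμ0 n
      have hνn := one_add_mul_ne_zero hν n
      have h1n := one_add_mul_ne_zero one_pos n
      have hδn : δ n = 0 := if_neg hn.ne'
      simp only [P, s, hδn, mul_zero, add_zero, H, κ, K, coeffMult]
      push_cast at h1n ⊢
      rw [one_mul] at h1n ⊢
      generalize hM : 1 + (μ : ℂ) * n = M at *
      generalize hN : 1 + (ν : ℂ) * n = N at *
      generalize hL : 1 + (n : ℂ) = L at *
      field_simp
      rw [← hL]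
      ring
  rw [e1, ConvOnDisc.pSum_const_mul, ConvOnDisc.pSum_const_mul, Complex.re_ofReal_mul] at key
  exact (mul_pos_iff_of_pos_left (sub_pos.2 hβ)).1 key

lemma V_eq {lam : ℝ → ℝ} (hl : Admissible lam) {f : ℂ → ℂ} {c : ℕ → ℂ} (hc : ConvOnDisc c)
    (h : ∀ z : ℂ, ‖z‖ < 1 → f z = z * pSum c z) {z : ℂ} (hz : ‖z‖ < 1) :
    V lam f z = z * pSum (fun n => moment lam n * c n) z := by
  rw [← hc.integral_weight_mul_pSum hl.integrable hz, ← intervalIntegral.integral_const_mul, V]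
  refine intervalIntegral.integral_congr_ae (.of_forall fun t ht => ?_)
  rw [Set.uIoc_of_le zero_le_one] at ht
  have ht0 : (t : ℂ) ≠ 0 := by exact_mod_cast ht.1.ne'
  rw [h _ (norm_ofReal_mul_lt ht.1.le ht.2 hz)]
  field_simp

/-- With `E` the coefficients `(1 + ξ n) dₙ`, the denominator in `classM` is `z * pSum E z` and the
numerator is `z` times its derivative, so the unimodular test applies with `B - A` the series of `n
Eₙ`. -/
lemma mem_classM_of_coeff {F : ℂ → ℂ} {d : ℕ → ℂ} (hd : ConvOnDisc d) (hd0 : d 0 = 1)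
    (hF : ∀ z : ℂ, ‖z‖ < 1 → F z = z * pSum d z) {ξ : ℝ}
    (h : ∀ z : ℂ, ‖z‖ < 1 → ∃ e : ℂ, e ≠ 0 ∧ ∀ x : ℂ, ‖x‖ = 1 →
      0 < (e * pSum (fun n => starCoeff x n * ((1 + (ξ : ℂ) * n) * d n)) z).re) :
    F ∈ classM ξ := by
  have hd1 : ConvOnDisc fun n => (1 + (n : ℂ)) * d n := by simpa using hd.linear_mul 1 1
  have hE : ConvOnDisc fun n => (1 + (ξ : ℂ) * n) * d n := hd.linear_mul 1 ξ
  have hF' : ∀ w : ℂ, ‖w‖ < 1 → deriv F w = pSum (fun n => (1 + (n : ℂ)) * d n) w := fun w hw => by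
    rw [deriv_eq_of_eqOn_disc hF hw, hd.deriv_id_mul hw]
  refine ⟨⟨?_, ?_, ?_⟩, fun z hz hz0 => ?_⟩
  · exact (differentiableOn_id.mul hd.differentiableOn).congr fun w hw =>
      hF w (mem_ball_zero_iff.1 hw)
  · rw [hF 0 (by simp), zero_mul]
  · rw [hF' 0 (by simp), pSum_zero]; simp [hd0]
  · have hz' := mem_ball_zero_iff.1 hz
    obtain ⟨e, he, hx⟩ := h z hz'
    set E : ℕ → ℂ := fun n => (1 + (ξ : ℂ) * n) * d n with hEdef
    have hnum : (ξ : ℂ) * z * deriv (fun w => w * deriv F w) z + (1 - (ξ : ℂ)) * (z * deriv F z) =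
        z * (pSum E z + pSum (fun n => (n : ℂ) * E n) z) := by
      rw [deriv_eq_of_eqOn_disc (G := fun w => w * pSum (fun n => (1 + (n : ℂ)) * d n) w)
        (fun w hw => by rw [hF' w hw]) hz', hd1.deriv_id_mul hz', hF' z hz',
        ← hE.pSum_add hE.natCast_mul hz']
      have h1 : ConvOnDisc fun n => (1 + (n : ℂ)) * ((1 + (n : ℂ)) * d n) := by
        simpa using hd1.linear_mul 1 1
      have : (fun n : ℕ => E n + n * E n) = fun n : ℕ => (ξ : ℂ) *
          ((1 + (n : ℂ)) * ((1 + (n : ℂ)) * d n)) + (1 - (ξ : ℂ)) * ((1 + (n : ℂ)) * d n) := by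
        ext n; simp only [hEdef]; ring
      rw [this, (h1.const_mul _).pSum_add (hd1.const_mul _) hz', ConvOnDisc.pSum_const_mul,
        ConvOnDisc.pSum_const_mul]
      ring
    have hden : (ξ : ℂ) * (z * deriv F z) + (1 - (ξ : ℂ)) * F z = z * pSum E z := by
      rw [hF' z hz', hF z hz']
      have : E = fun n : ℕ => (ξ : ℂ) * ((1 + (n : ℂ)) * d n) + (1 - (ξ : ℂ)) * d n := by
        ext n; simp only [hEdef]; ring
      rw [this, (hd1.const_mul _).pSum_add (hd.const_mul _) hz', ConvOnDisc.pSum_const_mul,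
        ConvOnDisc.pSum_const_mul]
      ring
    rw [hnum, hden, mul_div_mul_left _ _ hz0]
    refine re_div_pos_of_forall_unit he fun x hx1 => ?_
    have := hx x hx1
    have e1 : (fun n => starCoeff x n * E n) = fun n => E n + (1 + x) / 2 * (n * E n) := by
      ext n; rw [starCoeff]; ring
    rw [e1, hE.pSum_add (hE.natCast_mul.const_mul _) hz', ConvOnDisc.pSum_const_mul] at this
    rwa [add_sub_cancel_left]

end Pascu

/-! ### Assembly of the theorem. -/

theorem mainTheorem7 (ξ a b α β γ μ ν : ℝ)
    (hξ0 : 0 ≤ ξ) (hξ1 : ξ ≤ 1) (ha : -1 < a) (hb : -1 < b)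
    (hα : 0 ≤ α) (hγ : 0 < γ) (hμ : 1 ≤ μ) (hν : 0 < ν)
    (hsum : μ + ν = α - γ) (hprod : μ * ν = γ)
    (hβ : β < 1)
    (hβeq : (β - 1 / 2) / (1 - β) =
      -∫ t in (0 : ℝ)..1, Pascu.weight a b t * Pascu.q μ ν t)
    (hcond :
      (a < b ∧ -1 < a ∧ a < 0 ∧ b + a - 1 < 1 / μ ∧ 1 / μ < b - 1) ∨
      (b < a ∧ -1 < b ∧ b < 0 ∧ b + a - 1 < 1 / μ ∧ 1 / μ < a - 1) ∨
      (b = a ∧ a < 0 ∧ b - 1 < 1 / μ)) :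
    ∀ f ∈ Pascu.classW β α γ, Pascu.V (Pascu.weight a b) f ∈ Pascu.classM ξ := by
  -- In the first two cases this upgrades `b + a - 1 < 1 / μ` to the bound `a + b ≤ 2` needed for
  -- admissibility.
  have hμ1 : 1 / μ ≤ 1 := (div_le_one (zero_lt_one.trans_le hμ)).2 hμ
  have hl : Pascu.Admissible (Pascu.weight a b) := by
    rcases hcond with ⟨h1, -, h2, h3, -⟩ | ⟨h1, -, h2, h3, -⟩ | ⟨rfl, h2, -⟩
    · exact Pascu.admissible_weight_of_lt ha h1 h2.le (by linarith)
    · exact Pascu.admissible_weight_of_gt hb h1 h2.le (by linarith)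
    · exact Pascu.admissible_weight_self ha h2.le
  rintro f ⟨hf, φ, hφ⟩
  obtain ⟨c, hc, hc0, hfc⟩ := Pascu.exists_coeff_of_mem_classA hf
  refine Pascu.mem_classM_of_coeff (hc.moment_mul hl.integrable) ?_
    (fun z hz => Pascu.V_eq hl hc (fun w hw => (hfc w hw).2) hz)
    fun z hz => ⟨Complex.exp (Complex.I * (φ : ℂ)), Complex.exp_ne_zero _, fun x hx => ?_⟩
  · simpa [Pascu.moment, hc0] using hl.integral_eq
  · refine Pascu.re_exp_mul_pSum_pos hl hx hξ0 hξ1 hμ hν hβ hβeq hc hc0 (fun w hw => ?_) hz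
    rw [← Pascu.classW_expr_eq_pSum hc hfc hsum hprod hw]
    exact hφ w (mem_ball_zero_iff.2 hw)
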